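/- For $c\in(0,1)\cap\mathbb{Q}$, $\alpha\in\mathbb{R}\setminus\mathbb{Q}$ and an integer $n\ge 0$ let $$D_n(\alpha,c)=\sum_{j=1}^n 1_{[0,c)}(\{j\alpha\})-nc,$$ where $\{x\}$ denotes the fractional part of $x$, and let $O_c$ be the set of all irrational real numbers $\alpha$ for which the sequence $(D_n(\alpha,c))_{n\ge 0}$ is one-side bounded, i.e. bounded above or bounded below. Then for every $c\in(0,1)\cap\mathbb{Q}$: (1) $O_c$ is dense in $\mathbb{R}^+=(0,\infty)$, i.e. $O_c\cap(0,\infty)$ is dense in $(0,\infty)$; (2) $O_c$ is of first Baire category in $\mathbb{R}$ (a countable union of nowhere dense sets); (3) the Hausdorff dimension of $O_c$ satisfies $0<\dim_H(O_c)<1$; hence $O_c$ is uncountable, has Lebesgue measure $0$, and is totally disconnected. -/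

import Mathlib

namespace RotationDiscrepancy

/-- The local discrepancy `D_n(ω, c) = ∑_{j=1}^n 1_{[0,c)}(ω_j) - n c` of a sequence
`ω = (ω_j : j ≥ 1)`; the value `ω 0` is never used. -/
noncomputable def localDiscrepancy (ω : ℕ → ℝ) (c : ℝ) (n : ℕ) : ℝ :=
  ∑ j ∈ Finset.Icc 1 n, (Set.Ico (0 : ℝ) c).indicator (fun _ => (1 : ℝ)) (ω j) - (n : ℝ) * c

/-- The sequence `n ↦ {n α + θ}` driven by the rotation by `α` with starting point `θ`. -/
noncomputable def rotationSeq (α θ : ℝ) (n : ℕ) : ℝ :=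
  Int.fract ((n : ℝ) * α + θ)

/-- `D_n(α, c)`: the local discrepancy at `c` of the rotation by `α` started at `0`. -/
noncomputable def discrepancy (α c : ℝ) (n : ℕ) : ℝ :=
  localDiscrepancy (rotationSeq α 0) c n

/-- A real sequence is one-side bounded if it is bounded above or bounded below. -/
def OneSideBounded (D : ℕ → ℝ) : Prop :=
  BddAbove (Set.range D) ∨ BddBelow (Set.range D)

/-- `O_c`: the set of irrational `α` for which `(D_n(α, c))` is one-side bounded. -/
def oneSideBoundedSet (c : ℝ) : Set ℝ :=
  {α : ℝ | Irrational α ∧ OneSideBounded (discrepancy α c)}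

end RotationDiscrepancy

/-!
Write `c = p/q` in lowest terms, and let `α` lie between consecutive convergents `P/Q < α < S/R`
(convergents from below and from above).

*A condition for boundedness.* Suppose that, from some point on, `q` divides the denominators of all
convergents from below; this persists when every second partial quotient is `q`. Over a block of
length `Q` with `q ∣ Q` the points `jα` are perturbations of the multiples of `1/Q`,
among which `0` and `c` are; the number of visits to `[0, c)` can exceed
`Qc` only if a point of the block comes very close to `0` from the right (`card_hits_upper`), and by
best approximation this takes many steps. Once that many steps have been made, a point of the orbit
is so close to `0` from the right that each block of length `R` has at least `Rc` visits
(`card_hits_lower`). So the value of the discrepancy at any large time is at most its value at some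
smaller time, and it is bounded above (`bddAbove_of_chain`). Such `α` can be prescribed to be near
any given number, and contain a Cantor set that a Hölder map sends onto `[0, 1]` (one free binary
digit in each pair of partial quotients). This gives density and positive dimension.

*A condition for unboundedness.* If `P/Q < α` is a very good approximation and `q ∤ Q`, then a block
of length `Q` starting near `0` has at least `Qc + 1/q` visits, again by `card_hits_lower`. Infinitely
many such approximations make the discrepancy unbounded above (`exists_large_discrepancy`). So
boundedness above forces `α` into one of countably many sets `avoidingSet q N`, on which good
approximations from below with denominator at least `N` and not divisible by `q` are forbidden. The
reflection `α ↦ -α`, `c ↦ 1 - c` reduces boundedness below to boundedness above.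

The complement of `avoidingSet q N` contains a dense open set, whence first category. For the
dimension, each continued fraction cylinder loses a grandchild of comparable length: some digit
`a ∈ {1, 2}` leads to a denominator not divisible by `q`, and then the digit `4q` creates a forbidden
approximation. The sum of `s`-th powers of the lengths of the grandchildren of a cylinder tends,
uniformly, to the length of the cylinder as `s → 1`, so for some `s < 1` the sum over the remaining
grandchildren is at most the `s`-th power of the length of the cylinder
(`exists_tsum_grandchild_le`), and the `s`-dimensional Hausdorff measure of the part of
`avoidingSet q N` in each cylinder is finite.
-/

namespace RotationDiscrepancy

open Filter Topology MeasureTheory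
open scoped ENNReal NNReal

/-! ### Counting hits of `[0, c)` in a window of times -/

/-- The times `j ∈ (m, n]` at which the orbit of `0` under the rotation by `α` visits `[0, c)`. -/
noncomputable def hits (α c : ℝ) (m n : ℕ) : Finset ℕ :=
  (Finset.Ioc m n).filter fun j => Int.fract ((j : ℝ) * α) < c

lemma discrepancy_eq_card (α c : ℝ) (n : ℕ) :
    discrepancy α c n = ((hits α c 0 n).card : ℝ) - n * c := by
  unfold discrepancy localDiscrepancy rotationSeq hits
  congr 1
  rw [Finset.card_filter, Nat.cast_sum]
  refine Finset.sum_congr (by ext; simp [Nat.succ_le_iff]) fun j _ => ?_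
  simp [Set.indicator, Int.fract_nonneg]

lemma discrepancy_add_sub (α c : ℝ) (m Q : ℕ) :
    discrepancy α c (m + Q) - discrepancy α c m = ((hits α c m (m + Q)).card : ℝ) - Q * c := by
  rw [discrepancy_eq_card, discrepancy_eq_card]
  have h : hits α c 0 (m + Q) = hits α c 0 m ∪ hits α c m (m + Q) := by
    unfold hits
    rw [← Finset.filter_union, Finset.Ioc_union_Ioc_eq_Ioc (Nat.zero_le _) (Nat.le_add_right _ _)]
  have hd : Disjoint (hits α c 0 m) (hits α c m (m + Q)) := by
    rw [Finset.disjoint_left]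
    intro j hj hj'
    simp only [hits, Finset.mem_filter, Finset.mem_Ioc] at hj hj'
    omega
  rw [h, Finset.card_union_of_disjoint hd]
  push_cast
  ring

lemma discrepancy_zero (α c : ℝ) : discrepancy α c 0 = 0 := by
  simp [discrepancy, localDiscrepancy]

/-- In a window of `Q` consecutive times, `(j - j₀) P` runs through each residue modulo `Q` once. -/
lemma residue_injOn {Q m : ℕ} {P : ℤ} (j₀ : ℕ) (hP : IsCoprime P (Q : ℤ)) :
    Set.InjOn (fun j : ℕ => (((j : ℤ) - j₀) * P) % (Q : ℤ)) (Finset.Ioc m (m + Q)) := by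
  intro i hi j hj hij
  simp only [Finset.coe_Ioc, Set.mem_Ioc] at hi hj
  have h1 : (Q : ℤ) ∣ ((j : ℤ) - j₀) * P - ((i : ℤ) - j₀) * P := Int.ModEq.dvd hij
  have h2 : (Q : ℤ) ∣ (j : ℤ) - i := by
    refine hP.symm.dvd_of_dvd_mul_right ?_
    rwa [← sub_mul, sub_sub_sub_cancel_right] at h1
  have h3 := Int.eq_zero_of_abs_lt_dvd h2 (by rw [abs_lt]; constructor <;> omega)
  omega

lemma residue_image {Q m : ℕ} {P : ℤ} (j₀ : ℕ) (hQ : 0 < Q) (hP : IsCoprime P (Q : ℤ)) :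
    (Finset.Ioc m (m + Q)).image (fun j : ℕ => (((j : ℤ) - j₀) * P) % (Q : ℤ)) =
      Finset.Ico 0 (Q : ℤ) := by
  apply Finset.eq_of_subset_of_card_le
  · intro r hr
    obtain ⟨j, -, rfl⟩ := Finset.mem_image.1 hr
    have hQ' : (0 : ℤ) < Q := by exact_mod_cast hQ
    exact Finset.mem_Ico.2 ⟨Int.emod_nonneg _ hQ'.ne', Int.emod_lt_of_pos _ hQ'⟩
  · rw [Finset.card_image_of_injOn (residue_injOn j₀ hP)]
    simp

/-- The position of the orbit at time `j`, relative to that at time `j₀`. -/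
lemma orbit_eq {α : ℝ} {Q : ℕ} (P : ℤ) (hQ : 0 < Q) (j₀ j : ℕ) :
    (j : ℝ) * α =
      ((⌊(j₀ : ℝ) * α⌋ + (((j : ℤ) - j₀) * P) / (Q : ℤ) : ℤ) : ℝ) +
        (Int.fract ((j₀ : ℝ) * α) + ((((j : ℤ) - j₀) * P % (Q : ℤ) : ℤ) : ℝ) / Q +
          ((j : ℝ) - j₀) * (Q * α - P) / Q) := by
  have hQ' : (Q : ℝ) ≠ 0 := by positivity
  have h1 := Int.mul_ediv_add_emod (((j : ℤ) - j₀) * P) (Q : ℤ)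
  have h2 : (Q : ℝ) * ((((j : ℤ) - j₀) * P / (Q : ℤ) : ℤ) : ℝ) +
      ((((j : ℤ) - j₀) * P % (Q : ℤ) : ℤ) : ℝ) = ((j : ℝ) - j₀) * P := by
    exact_mod_cast h1
  have h3 := Int.floor_add_fract ((j₀ : ℝ) * α)
  push_cast
  have h4 : ((((j : ℤ) - j₀) * P / (Q : ℤ) : ℤ) : ℝ) =
      (((j : ℝ) - j₀) * P - ((((j : ℤ) - j₀) * P % (Q : ℤ) : ℤ) : ℝ)) / Q := by
    field_simp
    linarith
  rw [h4]
  generalize ((((j : ℤ) - j₀) * P % (Q : ℤ) : ℤ) : ℝ) = r at *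
  have : (j : ℝ) * α = (j₀ : ℝ) * α + (j - j₀) * α := by ring
  rw [this]
  field_simp
  linear_combination (-(Q : ℝ)) * h3

/-- If some point of a window of length `Q` lies just to the right of `0`, at a distance less than
`{Qc}/Q - |Qα - P|`, then the points `j₀α + r/Q` with `0 ≤ r ≤ ⌊Qc⌋`, of which the orbit points are
small perturbations, all stay inside `[0, c)`. -/
lemma card_hits_lower {α c : ℝ} {Q : ℕ} {P : ℤ} {m j₀ : ℕ} (hQ : 0 < Q)
    (hP : IsCoprime P (Q : ℤ)) (hc0 : 0 ≤ c) (hc1 : c < 1) (hj₀ : j₀ ∈ Finset.Ioc m (m + Q))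
    (h : Int.fract ((j₀ : ℝ) * α) + |Q * α - P| < Int.fract ((Q : ℝ) * c) / Q) :
    ⌊(Q : ℝ) * c⌋ + 1 ≤ ((hits α c m (m + Q)).card : ℤ) := by
  have hQ' : (0 : ℝ) < Q := by exact_mod_cast hQ
  set C := ⌊(Q : ℝ) * c⌋ with hC
  have hC0 : 0 ≤ C := Int.floor_nonneg.2 (by positivity)
  have hfr : Int.fract ((Q : ℝ) * c) = Q * c - C := rfl
  have hfr1 := Int.fract_lt_one ((Q : ℝ) * c)
  have hCQ : C < Q := Int.floor_lt.2 (by push_cast; nlinarith)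
  have hsub : Finset.Icc 0 C ⊆
      (hits α c m (m + Q)).image (fun j : ℕ => (((j : ℤ) - j₀) * P) % (Q : ℤ)) := by
    intro r hr
    rw [Finset.mem_Icc] at hr
    have hr' : r ∈ Finset.Ico 0 (Q : ℤ) := Finset.mem_Ico.2 ⟨hr.1, by omega⟩
    rw [← residue_image (m := m) j₀ hQ hP] at hr'
    obtain ⟨j, hj, hjr⟩ := Finset.mem_image.1 hr'
    refine Finset.mem_image.2 ⟨j, ?_, hjr⟩
    rw [hits, Finset.mem_filter]
    refine ⟨hj, ?_⟩
    have horb := orbit_eq (α := α) P hQ j₀ j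
    rw [hjr] at horb
    rw [horb, Int.fract_intCast_add]
    set z := Int.fract ((j₀ : ℝ) * α)
    have hz : 0 ≤ z := Int.fract_nonneg _
    rw [Finset.mem_Ioc] at hj hj₀
    have hl : |(j : ℝ) - j₀| ≤ Q := by
      rw [abs_le]
      have h1 : (j : ℝ) ≤ m + Q := by exact_mod_cast hj.2
      have h2 : (j₀ : ℝ) ≤ m + Q := by exact_mod_cast hj₀.2
      have h3 : (m : ℝ) < j := by exact_mod_cast hj.1
      have h4 : (m : ℝ) < j₀ := by exact_mod_cast hj₀.1
      constructor <;> linarith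
    have hpert : |((j : ℝ) - j₀) * (Q * α - P) / Q| ≤ |Q * α - P| := by
      rw [abs_div, abs_mul, abs_of_pos hQ', div_le_iff₀ hQ', mul_comm]
      exact mul_le_mul_of_nonneg_left hl (abs_nonneg _)
    have hsum : (C : ℝ) / Q + Int.fract ((Q : ℝ) * c) / Q = c := by
      rw [hfr]; field_simp; ring
    have hs1 : Int.fract ((Q : ℝ) * c) / Q < 1 / Q := by gcongr
    rcases eq_or_lt_of_le hr.1 with h0 | h0
    · have hdv : (Q : ℤ) ∣ (j : ℤ) - j₀ := by
        refine hP.symm.dvd_of_dvd_mul_right ?_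
        exact Int.dvd_of_emod_eq_zero (by rw [hjr, ← h0])
      have h3 := Int.eq_zero_of_abs_lt_dvd hdv (by rw [abs_lt]; constructor <;> omega)
      have h4 : (j : ℝ) - j₀ = 0 := by exact_mod_cast h3
      have hzc : z < c := by
        have : (0 : ℝ) ≤ C / Q := by positivity
        have := abs_nonneg ((Q : ℝ) * α - P)
        linarith
      rw [← h0, h4]
      simp only [Int.cast_zero, zero_div, add_zero, zero_mul]
      rwa [Int.fract_eq_self.2 ⟨hz, by linarith⟩]
    · have h1r : (1 : ℝ) / Q ≤ r / Q := by
        gcongr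
        exact_mod_cast h0
      have hrC : (r : ℝ) / Q ≤ C / Q := by
        gcongr
        exact_mod_cast hr.2
      rw [abs_le] at hpert
      rw [Int.fract_eq_self.2 ⟨by linarith, by linarith⟩]
      linarith
  have h1 := Finset.card_le_card hsub
  have h2 := h1.trans Finset.card_image_le
  rw [Int.card_Icc] at h2
  omega

/-- Suppose `Qc` is an integer and `P/Q < α` is a good approximation. A window of length `Q` can
contain more than `Qc` hits only if some orbit point in it lies within `σ(Qα - P)/Q` to the right
of `0`, where `σ P ≡ -Qc` modulo `Q`. -/
lemma card_hits_upper {α c : ℝ} {Q : ℕ} {P C σ : ℤ} {m : ℕ} (hQ : 0 < Q)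
    (hP : IsCoprime P (Q : ℤ)) (hc0 : 0 ≤ c) (hc1 : c < 1) (hC : (Q : ℝ) * c = C)
    (hθ : 0 < Q * α - P) (hθ' : Q * (Q * α - P) < 1)
    (hσ0 : 0 < σ) (hσ : (Q : ℤ) ∣ σ * P + C)
    (h : ∀ j ∈ Finset.Ioc m (m + Q), σ * (Q * α - P) / Q ≤ Int.fract ((j : ℝ) * α)) :
    ((hits α c m (m + Q)).card : ℤ) ≤ C := by
  have hQ' : (0 : ℝ) < Q := by exact_mod_cast hQ
  obtain ⟨j₀, hj₀, hmin⟩ := Finset.exists_min_image (Finset.Ioc m (m + Q))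
    (fun j : ℕ => Int.fract ((j : ℝ) * α)) ⟨m + Q, by simp [hQ]⟩
  have hcQ : c = C / Q := by field_simp; linarith
  have hCQ : C < Q := by
    have : (C : ℝ) < Q := by rw [← hC]; nlinarith
    exact_mod_cast this
  have hsub : (hits α c m (m + Q)).image (fun j : ℕ => (((j : ℤ) - j₀) * P) % (Q : ℤ)) ⊆
      Finset.Ico 0 C := by
    intro r hr
    obtain ⟨j, hj, hjr⟩ := Finset.mem_image.1 hr
    rw [hits, Finset.mem_filter] at hj
    obtain ⟨hj, hjc⟩ := hj
    have hQZ : (0 : ℤ) < Q := by exact_mod_cast hQ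
    have hr0 : 0 ≤ r := by rw [← hjr]; exact Int.emod_nonneg _ hQZ.ne'
    have hrQ : r < Q := by rw [← hjr]; exact Int.emod_lt_of_pos _ hQZ
    rw [Finset.mem_Ico]
    refine ⟨hr0, ?_⟩
    by_contra hrC
    push Not at hrC
    have hz := hmin j hj
    have horb := orbit_eq (α := α) P hQ j₀ j
    rw [hjr] at horb
    have hz₀ := h j₀ hj₀
    have hz1 := Int.fract_lt_one ((j₀ : ℝ) * α)
    have hz0 := Int.fract_nonneg ((j₀ : ℝ) * α)
    rw [horb, Int.fract_intCast_add] at hjc hz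
    set z := Int.fract ((j₀ : ℝ) * α)
    set θ := (Q : ℝ) * α - P
    set v := z + (r : ℝ) / Q + ((j : ℝ) - j₀) * θ / Q with hv
    rw [Finset.mem_Ioc] at hj hj₀
    have hl : (j : ℝ) - j₀ < Q ∧ -(Q : ℝ) < (j : ℝ) - j₀ := by
      have h1 : (j : ℝ) ≤ m + Q := by exact_mod_cast hj.2
      have h2 : (j₀ : ℝ) ≤ m + Q := by exact_mod_cast hj₀.2
      have h3 : (m : ℝ) < j := by exact_mod_cast hj.1
      have h4 : (m : ℝ) < j₀ := by exact_mod_cast hj₀.1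
      constructor <;> linarith
    have hθQ : θ < 1 / Q := by rw [lt_div_iff₀ hQ']; linarith
    have hp1 : ((j : ℝ) - j₀) * θ / Q < θ := by
      rw [div_lt_iff₀ hQ']; nlinarith [hl.1]
    have hp2 : -θ < ((j : ℝ) - j₀) * θ / Q := by
      rw [lt_div_iff₀ hQ']; nlinarith [hl.2]
    have hrQ1 : (r : ℝ) / Q ≤ 1 - 1 / Q := by
      rw [div_le_iff₀ hQ']
      field_simp
      have : r + 1 ≤ (Q : ℤ) := by omega
      have : (r : ℝ) + 1 ≤ Q := by exact_mod_cast this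
      linarith
    have hvz : v < 1 + z := by rw [hv]; linarith
    have hvc : c ≤ v := by
      rcases eq_or_lt_of_le hrC with h0 | h0
      · -- The residue `C` is taken at `j - j₀ ≡ -σ`, so at `-σ` or at `Q - σ`.
        have hdv : (Q : ℤ) ∣ ((j : ℤ) - j₀) + σ := by
          refine hP.symm.dvd_of_dvd_mul_right ?_
          have h1 : (Q : ℤ) ∣ ((j : ℤ) - j₀) * P - C := by
            rw [h0, ← hjr]
            exact Int.dvd_self_sub_emod
          convert dvd_add h1 hσ using 1
          ring
        obtain ⟨k, hk⟩ := hdv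
        have hk0 : 0 ≤ k := by
          by_contra hneg
          have : k ≤ -1 := by omega
          nlinarith
        have hlσ : -(σ : ℝ) ≤ (j : ℝ) - j₀ := by
          have : 0 ≤ (j : ℤ) - j₀ + σ := by rw [hk]; positivity
          have : (0 : ℝ) ≤ (j : ℝ) - j₀ + σ := by exact_mod_cast this
          linarith
        have : -(σ * θ / Q) ≤ ((j : ℝ) - j₀) * θ / Q := by
          rw [← neg_div]
          gcongr
          nlinarith
        rw [hv, hcQ, h0]
        linarith
      · have : c + 1 / Q ≤ (r : ℝ) / Q := by
          rw [hcQ, ← add_div]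
          gcongr
          exact_mod_cast h0
        linarith
    rcases lt_or_ge v 1 with hv1 | hv1
    · have hv0 : 0 ≤ v := hc0.trans hvc
      rw [Int.fract_eq_self.2 ⟨hv0, hv1⟩] at hjc
      linarith
    · have h5 : Int.fract v = v - 1 := by
        rw [Int.fract_eq_iff]
        refine ⟨by linarith, by linarith, 1, by push_cast; ring⟩
      rw [h5] at hz
      linarith
  have hC0 : 0 ≤ C := by
    have : (0 : ℝ) ≤ C := by rw [← hC]; positivity
    exact_mod_cast this
  have h1 := Finset.card_le_card hsub
  rw [Finset.card_image_of_injOn, Int.card_Ico] at h1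
  · omega
  · exact (residue_injOn j₀ hP).mono (by
      intro j hj
      simp only [hits, Finset.coe_filter, Set.mem_ofPred_eq] at hj
      exact hj.1)

/-! ### Rotations with discrepancy bounded above -/

lemma fract_natCast_mul_div (p R : ℕ) {q : ℕ} (hq : 0 < q) :
    Int.fract ((R : ℝ) * (p / q : ℝ)) = ((p * R % q : ℕ) : ℝ) / q := by
  have hq' : (0 : ℝ) < q := by exact_mod_cast hq
  rw [Int.fract_eq_iff]
  refine ⟨by positivity, ?_, (p * R / q : ℕ), ?_⟩
  · rw [div_lt_one hq']
    exact_mod_cast Nat.mod_lt _ hq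
  · have h1 : (q : ℝ) * ((p * R / q : ℕ) : ℝ) + ((p * R % q : ℕ) : ℝ) = (p : ℝ) * R := by
      exact_mod_cast Nat.div_add_mod (p * R) q
    rw [Int.cast_natCast]
    field_simp
    linarith

/-- Two consecutive approximations `P/Q < α < S/R` of `α`, with `SQ - PR = 1` and `q ∣ Q`, such
that the next partial quotient of `α` is `q`. -/
structure ApproxPair (q : ℕ) (α : ℝ) (Q R : ℕ) (P S : ℤ) : Prop where
  det : S * Q - P * R = 1
  dvd : q ∣ Q
  pos : 0 < Q
  le : Q ≤ R
  left_pos : 0 < (Q : ℝ) * α - P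
  right_pos : 0 < S - (R : ℝ) * α
  next_pos : 0 < ((Q : ℝ) * α - P) - q * (S - R * α)
  next_lt : ((Q : ℝ) * α - P) - q * (S - R * α) < S - R * α

namespace ApproxPair

variable {p q : ℕ} {α : ℝ} {Q R : ℕ} {P S : ℤ}

lemma det_real (h : ApproxPair q α Q R P S) : (S : ℝ) * Q - P * R = 1 := by
  exact_mod_cast h.det

lemma det_theta (h : ApproxPair q α Q R P S) :
    (R : ℝ) * (Q * α - P) + Q * (S - R * α) = 1 := by
  linear_combination h.det_real

lemma isCoprime_left (h : ApproxPair q α Q R P S) : IsCoprime P (Q : ℤ) :=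
  ⟨-R, S, by linear_combination h.det⟩

lemma isCoprime_right (h : ApproxPair q α Q R P S) : IsCoprime S (R : ℤ) :=
  ⟨Q, -P, by linear_combination h.det⟩

lemma coprime (h : ApproxPair q α Q R P S) : Nat.Coprime q R := by
  have h1 : IsCoprime (q : ℤ) (R : ℤ) := by
    obtain ⟨k, hk⟩ := h.dvd
    refine ⟨S * k, -P, ?_⟩
    have := h.det
    rw [hk] at this
    push_cast at this
    linear_combination this
  exact Nat.isCoprime_iff_coprime.1 h1

/-- The times before `Q + (T+1)R` at which the orbit is close to `0` from the right are of the form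
`xQ + yR` with `x, y ≥ 1`, and small values of `y` give a distance that is still large. -/
lemma fract_lower (h : ApproxPair q α Q R P S) (hq : 0 < q) {T m : ℕ} (hm : 0 < m)
    (hmT : m < Q + (T + 1) * R) :
    ((q : ℝ) - T) / q * (Q * α - P) ≤ Int.fract ((m : ℝ) * α) := by
  by_contra hlt
  push Not at hlt
  have hθ := h.left_pos
  have hη := h.right_pos
  have hnext := h.next_pos
  set l := ⌊(m : ℝ) * α⌋ with hl
  set x : ℤ := m * S - l * R with hx
  set y : ℤ := -(m * P) + l * Q with hy
  have hmxy : (m : ℤ) = x * Q + y * R := by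
    rw [hx, hy]; linear_combination (-(m : ℤ)) * h.det
  have hlxy : l = x * P + y * S := by
    rw [hx, hy]; linear_combination (-l) * h.det
  have hfr : Int.fract ((m : ℝ) * α) = x * (Q * α - P) - y * (S - R * α) := by
    have h1 : Int.fract ((m : ℝ) * α) = m * α - l := rfl
    have h2 : (m : ℝ) = x * Q + y * R := by exact_mod_cast hmxy
    have h3 : (l : ℝ) = x * P + y * S := by exact_mod_cast hlxy
    rw [h1, h2, h3]; ring
  have hf0 := Int.fract_nonneg ((m : ℝ) * α)
  rw [hfr] at hlt hf0
  set θ := (Q : ℝ) * α - P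
  set η := (S : ℝ) - R * α
  have hq' : (0 : ℝ) < q := by exact_mod_cast hq
  have hs : ((q : ℝ) - T) / q * θ = θ - T / q * θ := by field_simp
  have hTq : 0 ≤ (T : ℝ) / q * θ := by positivity
  rw [hs] at hlt
  have hy1 : 1 ≤ y := by
    by_contra hy0
    have hy0 : y ≤ 0 := by omega
    have hy0' : (y : ℝ) ≤ 0 := by exact_mod_cast hy0
    have hx0 : x < 1 := by
      have : (x : ℝ) < 1 := by nlinarith
      exact_mod_cast this
    have : (m : ℤ) ≤ 0 := by
      rw [hmxy]
      have hQ := h.pos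
      nlinarith
    omega
  have hy1' : (1 : ℝ) ≤ y := by exact_mod_cast hy1
  have hx1 : 1 ≤ x := by
    have : (0 : ℝ) < x := by nlinarith
    have : 0 < x := by exact_mod_cast this
    omega
  have hx1' : (1 : ℝ) ≤ x := by exact_mod_cast hx1
  have hyT : (T : ℝ) < y := by
    have h1 : T * η ≤ (T : ℝ) / q * θ := by
      rw [div_mul_eq_mul_div, le_div_iff₀ hq']
      have : (0 : ℝ) ≤ T := by positivity
      nlinarith
    nlinarith
  have hyT' : (T : ℤ) + 1 ≤ y := by
    have : (T : ℤ) < y := by exact_mod_cast hyT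
    omega
  have : (m : ℤ) < Q + (T + 1) * R := by exact_mod_cast hmT
  have hQ : (0 : ℤ) < Q := by exact_mod_cast h.pos
  nlinarith [Int.natCast_nonneg R]

/-- In the notation of `card_hits_upper`, `σ = rQ/q` where `r` is the remainder of `pR` modulo `q`. -/
lemma discrepancy_add_left_le (h : ApproxPair q α Q R P S) (hp : 0 < p) (hpq : p < q)
    {m : ℕ} (hm : m < (q - p * R % q + 1) * R) :
    discrepancy α (p / q : ℝ) (m + Q) ≤ discrepancy α (p / q : ℝ) m := by
  have hq : 0 < q := hp.trans hpq
  have hq' : (0 : ℝ) < q := by exact_mod_cast hq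
  have hQ' : (0 : ℝ) < Q := by exact_mod_cast h.pos
  obtain ⟨k, hk⟩ := h.dvd
  have hk0 : 0 < k := Nat.pos_of_ne_zero (by rintro rfl; have := h.pos; omega)
  have hρq : p * R % q < q := Nat.mod_lt _ hq
  have hρ0 : 0 < p * R % q := by
    rcases Nat.eq_zero_or_pos (p * R % q) with h0 | h0
    · have h1 : q ∣ p := h.coprime.dvd_of_dvd_mul_right (Nat.dvd_of_mod_eq_zero h0)
      exact absurd (Nat.le_of_dvd hp h1) (by omega)
    · exact h0
  have hc1 : (p / q : ℝ) < 1 := by rw [div_lt_one hq']; exact_mod_cast hpq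
  have hC : (Q : ℝ) * (p / q : ℝ) = ((p * k : ℤ) : ℝ) := by
    rw [hk]; push_cast; field_simp
  have hdet := h.det_theta
  have hR' : (Q : ℝ) ≤ R := by exact_mod_cast h.le
  have hrd : (q : ℤ) ∣ (p * R : ℤ) - ((p * R % q : ℕ) : ℤ) := by
    push_cast
    exact Int.dvd_self_sub_emod
  generalize p * R % q = r at *
  have hup := card_hits_upper (m := m) (σ := r * k) h.pos h.isCoprime_left
    (by positivity) hc1 hC h.left_pos (by nlinarith [h.left_pos, h.right_pos])
    (by positivity)
    (by
      -- `PR ≡ -1` modulo `q`, so `rP ≡ pRP ≡ -p`.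
      have h1 : (q : ℤ) ∣ (r : ℤ) * P + p := by
        have h3 : (r : ℤ) * P + p = q * (p * S * k) - ((p * R : ℤ) - r) * P := by
          have := h.det
          rw [hk] at this
          push_cast at this ⊢
          linear_combination (-(p : ℤ)) * this
        rw [h3]
        exact dvd_sub (Dvd.intro _ rfl) (Dvd.dvd.mul_right hrd _)
      rw [hk, Nat.cast_mul]
      have h4 := mul_dvd_mul_right h1 (k : ℤ)
      rwa [show ((r : ℤ) * P + p) * k = r * k * P + p * k by ring] at h4)
    (by
      intro j hj
      rw [Finset.mem_Ioc] at hj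
      have h1 := h.fract_lower (T := q - r) hq (m := j) (by omega)
        (by have := hj.2; nlinarith)
      convert h1 using 1
      rw [Nat.cast_sub hρq.le, hk]
      push_cast
      have : (k : ℝ) ≠ 0 := by positivity
      field_simp
      ring)
  have hup' : ((hits α (p / q : ℝ) m (m + Q)).card : ℝ) ≤ ((p * k : ℤ) : ℝ) := by
    exact_mod_cast hup
  have hD := discrepancy_add_sub α (p / q : ℝ) m Q
  have hup' : ((hits α (p / q : ℝ) m (m + Q)).card : ℝ) ≤ ((p * k : ℤ) : ℝ) := by
    exact_mod_cast hup
  linarith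

/-- At the later times before the next denominator `qR + Q`, the last visit close to the right of `0`
is so close that `card_hits_lower` applies to blocks of length `R`. -/
lemma le_discrepancy_add_right (h : ApproxPair q α Q R P S) (hp : 0 < p) (hpq : p < q)
    {n : ℕ} (hn : Q + (q - p * R % q + 1) * R ≤ n) (hn' : n < q * R + Q) :
    discrepancy α (p / q : ℝ) n ≤ discrepancy α (p / q : ℝ) (n + R) := by
  have hq : 0 < q := hp.trans hpq
  have hq' : (0 : ℝ) < q := by exact_mod_cast hq
  have hR : 0 < R := h.pos.trans_le h.le
  have hR' : (0 : ℝ) < R := by exact_mod_cast hR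
  have hρq : p * R % q < q := Nat.mod_lt _ hq
  have hc1 : (p / q : ℝ) < 1 := by rw [div_lt_one hq']; exact_mod_cast hpq
  have hfrR := fract_natCast_mul_div p R hq
  generalize p * R % q = r at *
  obtain ⟨T, hT⟩ : ∃ T, T = q - r := ⟨_, rfl⟩
  rw [← hT] at hn
  have hθ := h.left_pos
  have hη := h.right_pos
  have hn1 := h.next_pos
  have hn2 := h.next_lt
  have hdet := h.det_theta
  -- The time `Q + yR` in `(n, n + R]` is the one at which the orbit is just right of `0`.
  set y := (n - Q) / R + 1 with hy
  have hy1 : R * ((n - Q) / R) + (n - Q) % R = n - Q := Nat.div_add_mod _ _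
  have hy2 : (n - Q) % R < R := Nat.mod_lt _ hR
  have hyT : T + 2 ≤ y := by
    have : T + 1 ≤ (n - Q) / R := by
      rw [Nat.le_div_iff_mul_le hR]; omega
    omega
  have hyq : y ≤ q := by
    have : (n - Q) / R < q := by
      rw [Nat.div_lt_iff_lt_mul hR]; omega
    omega
  have hj : Q + y * R ∈ Finset.Ioc n (n + R) := by
    have : y * R = R * ((n - Q) / R) + R := by rw [hy]; ring
    rw [Finset.mem_Ioc]
    constructor <;> omega
  have hyT' : (T : ℝ) + 2 ≤ y := by exact_mod_cast hyT
  have hyq' : (y : ℝ) ≤ q := by exact_mod_cast hyq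
  have hTq : (T : ℝ) = q - r := by rw [hT, Nat.cast_sub hρq.le]
  set θ := (Q : ℝ) * α - P with hθd
  set η := (S : ℝ) - R * α with hηd
  have hQ0 : (0 : ℝ) ≤ Q := by positivity
  have hQR : (Q : ℝ) ≤ R := by exact_mod_cast h.le
  obtain ⟨ρ, hρd⟩ : ∃ ρ : ℝ, ρ = r := ⟨_, rfl⟩
  rw [← hρd] at hTq hfrR
  have hρ0 : 0 ≤ ρ := by rw [hρd]; positivity
  have hρq' : ρ < q := by rw [hρd]; exact_mod_cast hρq
  have key : θ - y * η + η < ρ / q / R := by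
    have e1 : θ / q * ρ ≤ ρ / q / R := by
      rw [div_div, le_div_iff₀ (by positivity)]
      have : θ / q * ρ * (q * R) = ρ * (R * θ) := by field_simp
      rw [this]
      nlinarith [mul_nonneg hQ0 hη.le]
    have e2 : θ - y * η + η ≤ θ - (T + 1) * η := by nlinarith
    have e3 : θ - (T + 1) * η < θ / q * ρ := by
      have : θ / q * ρ = θ - θ / q * T := by rw [hTq]; field_simp; ring
      rw [this]
      have e4 : θ / q * T < (T + 1) * η := by
        have hT0 : (0 : ℝ) ≤ T := by positivity
        have hTle : (T : ℝ) ≤ q := by rw [hTq]; linarith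
        rw [div_mul_eq_mul_div, div_lt_iff₀ hq']
        -- `θ T < (q + 1) T η ≤ (T + 1) q η`
        rcases hT0.eq_or_lt with h0 | h0
        · rw [← h0]; simpa using mul_pos hη hq'
        · have e5 : θ * T < (q + 1) * η * T := by
            apply mul_lt_mul_of_pos_right _ h0
            linarith
          nlinarith [mul_le_mul_of_nonneg_left hTle hη.le]
      linarith
    linarith
  have hfr : Int.fract (((Q + y * R : ℕ) : ℝ) * α) = θ - y * η := by
    rw [Int.fract_eq_iff]
    have h1 : ρ / q / R ≤ 1 := by
      rw [div_div, div_le_one (by positivity)]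
      have : (1 : ℝ) ≤ R := by exact_mod_cast hR
      nlinarith
    refine ⟨by nlinarith [mul_le_mul_of_nonneg_right hyq' hη.le], by linarith, P + y * S, ?_⟩
    push_cast
    rw [hθd, hηd]; ring
  have hlow := card_hits_lower (α := α) (c := (p / q : ℝ)) (P := S) (m := n) (j₀ := Q + y * R)
    hR h.isCoprime_right (by positivity) hc1 hj (by
      rw [hfr, hfrR, abs_sub_comm, abs_of_pos hη]
      exact key)
  have hD := discrepancy_add_sub α (p / q : ℝ) n R
  have h1 : (⌊(R : ℝ) * (p / q : ℝ)⌋ : ℝ) + 1 ≤ ((hits α (p / q : ℝ) n (n + R)).card : ℝ) := by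
    exact_mod_cast hlow
  have h2 := Int.lt_floor_add_one ((R : ℝ) * (p / q : ℝ))
  linarith

end ApproxPair

/-- If the approximation pairs of `α` form an infinite chain, then the discrepancy at each time
`n ≥ Q 0` is at most that at a smaller time: in a first range of `n` going back by `Q k` does not
decrease it; otherwise going forward by `R k` does not decrease it, and after finitely many such
steps one may go back by `Q (k + 1)`. -/
lemma bddAbove_of_chain {p q : ℕ} {α : ℝ} (hp : 0 < p) (hpq : p < q)
    {Q R : ℕ → ℕ} {P S : ℕ → ℤ} (h : ∀ k, ApproxPair q α (Q k) (R k) (P k) (S k))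
    (hQ : ∀ k, Q (k + 1) = q * R k + Q k) (hR : ∀ k, R k ≤ R (k + 1)) :
    BddAbove (Set.range (discrepancy α (p / q : ℝ))) := by
  obtain ⟨M, hM⟩ := ((Finset.range (Q 0)).image (discrepancy α (p / q : ℝ))).exists_le
  have hq : 0 < q := hp.trans hpq
  have hback : ∀ k m, m < R k → discrepancy α (p / q : ℝ) (m + Q k) ≤
      discrepancy α (p / q : ℝ) m := fun k m hm =>
    (h k).discrepancy_add_left_le hp hpq
      (hm.trans_le (Nat.le_mul_of_pos_left _ (Nat.succ_pos _)))
  have hQR : ∀ k, k ≤ Q k := by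
    intro k
    induction k with
    | zero => exact Nat.zero_le _
    | succ k ih =>
      have h1 := Nat.le_mul_of_pos_left (R k) hq
      have h2 := (h k).pos
      have h3 := (h k).le
      rw [hQ]; omega
  have main : ∀ n, discrepancy α (p / q : ℝ) n ≤ M := by
    intro n
    induction n using Nat.strong_induction_on with
    | _ n ih =>
      by_cases hn0 : n < Q 0
      · exact hM _ (Finset.mem_image_of_mem _ (Finset.mem_range.2 hn0))
      · obtain ⟨k, hk1, hk2⟩ : ∃ k, Q k ≤ n ∧ n < Q (k + 1) := by
          by_contra hcon
          push Not at hcon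
          have : ∀ k, Q k ≤ n := fun k => by
            induction k with
            | zero => omega
            | succ k ihk => exact hcon k ihk
          have h1 := this (n + 1)
          have h2 := hQR (n + 1)
          omega
        by_cases hA : n < Q k + (q - p * R k % q + 1) * R k
        · have h1 := (h k).discrepancy_add_left_le hp hpq (m := n - Q k) (by omega)
          rw [Nat.sub_add_cancel hk1] at h1
          exact h1.trans (ih _ (by have := (h k).pos; omega))
        · push Not at hA
          have hRn : R k ≤ n := by
            have := Nat.le_mul_of_pos_left (R k) (show 0 < q - p * R k % q + 1 by omega)
            omega
          have climb : ∀ d n', Q (k + 1) + R k - n' ≤ d → n' < Q (k + 1) + R k →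
              Q k + (q - p * R k % q + 1) * R k ≤ n' → discrepancy α (p / q : ℝ) n' ≤ M := by
            intro d
            induction d with
            | zero => intro n' h1 h2 _; omega
            | succ d ihd =>
              intro n' h1 h2 h3
              by_cases hn' : n' < Q (k + 1)
              · have h4 := (h k).le_discrepancy_add_right hp hpq h3 (by rw [hQ] at hn'; exact hn')
                have h5 : 0 < R k := (h k).pos.trans_le (h k).le
                exact h4.trans (ihd _ (by omega) (by omega) (by omega))
              · push Not at hn'
                have h4 := hback (k + 1) (n' - Q (k + 1)) (by have := hR k; omega)
                rw [Nat.sub_add_cancel hn'] at h4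
                exact h4.trans (ih _ (by omega))
          exact climb _ n le_rfl (by omega) hA
  exact ⟨M, by rintro _ ⟨n, rfl⟩; exact main n⟩

/-! ### Numbers with prescribed partial quotients -/

/-- The finite continued fractions `[q; b₀, q, b₁, …, q, bₙ₋₁, q]`. -/
noncomputable def tailApprox (q : ℕ) : ℕ → (ℕ → ℕ) → ℝ
  | 0, _ => q
  | n + 1, b => q + 1 / (b 0 + 1 / tailApprox q n (fun k => b (k + 1)))

/-- The infinite continued fraction `[q; b₀, q, b₁, q, b₂, …]`, as the supremum (in fact the
increasing limit) of its finite truncations. -/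
noncomputable def tail (q : ℕ) (b : ℕ → ℕ) : ℝ := ⨆ n, tailApprox q n b

lemma tailApprox_mem {q : ℕ} (hq : 0 < q) (n : ℕ) :
    ∀ {b : ℕ → ℕ}, (∀ k, 0 < b k) → (q : ℝ) ≤ tailApprox q n b ∧ tailApprox q n b ≤ q + 1 := by
  have hq' : (0 : ℝ) < q := by exact_mod_cast hq
  induction n with
  | zero => intro b _; simp [tailApprox]
  | succ n ih =>
    intro b hb
    have h1 := (ih (b := fun k => b (k + 1)) (fun k => hb _)).1
    have h2 : 0 < 1 / tailApprox q n (fun k => b (k + 1)) := one_div_pos.2 (by linarith)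
    have h3 : (1 : ℝ) ≤ b 0 := by exact_mod_cast hb 0
    simp only [tailApprox]
    constructor
    · have : 0 < 1 / ((b 0 : ℝ) + 1 / tailApprox q n (fun k => b (k + 1))) := by positivity
      linarith
    · have : 1 / ((b 0 : ℝ) + 1 / tailApprox q n (fun k => b (k + 1))) ≤ 1 := by
        rw [div_le_one (by positivity)]; linarith
      linarith

lemma tailApprox_mono {q : ℕ} (hq : 0 < q) (n : ℕ) :
    ∀ {b : ℕ → ℕ}, (∀ k, 0 < b k) → tailApprox q n b ≤ tailApprox q (n + 1) b := by
  have hq' : (0 : ℝ) < q := by exact_mod_cast hq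
  induction n with
  | zero => intro b hb; exact (tailApprox_mem hq 1 hb).1
  | succ n ih =>
    intro b hb
    have h1 := ih (b := fun k => b (k + 1)) (fun k => hb _)
    have h2 := (tailApprox_mem hq n (b := fun k => b (k + 1)) (fun k => hb _)).1
    have h3 : (1 : ℝ) ≤ b 0 := by exact_mod_cast hb 0
    rw [tailApprox, tailApprox.eq_2 q b (n + 1)]
    have h5 : 0 < tailApprox q n (fun k => b (k + 1)) := by linarith
    have h4 : 0 < tailApprox q (n + 1) (fun k => b (k + 1)) := by linarith
    gcongr

lemma tendsto_tailApprox {q : ℕ} (hq : 0 < q) {b : ℕ → ℕ} (hb : ∀ k, 0 < b k) :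
    Tendsto (fun n => tailApprox q n b) atTop (𝓝 (tail q b)) :=
  tendsto_atTop_ciSup (monotone_nat_of_le_succ fun n => tailApprox_mono hq n hb)
    ⟨q + 1, by rintro _ ⟨n, rfl⟩; exact (tailApprox_mem hq n hb).2⟩

lemma tail_mem {q : ℕ} (hq : 0 < q) {b : ℕ → ℕ} (hb : ∀ k, 0 < b k) :
    (q : ℝ) ≤ tail q b ∧ tail q b ≤ q + 1 :=
  ⟨ge_of_tendsto' (tendsto_tailApprox hq hb) fun n => (tailApprox_mem hq n hb).1,
    le_of_tendsto' (tendsto_tailApprox hq hb) fun n => (tailApprox_mem hq n hb).2⟩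

lemma tail_eq {q : ℕ} (hq : 0 < q) {b : ℕ → ℕ} (hb : ∀ k, 0 < b k) :
    tail q b = q + 1 / (b 0 + 1 / tail q (fun k => b (k + 1))) := by
  have hq' : (0 : ℝ) < q := by exact_mod_cast hq
  have h1 := tendsto_tailApprox hq (b := fun k => b (k + 1)) (fun k => hb _)
  have h2 := (tail_mem hq (b := fun k => b (k + 1)) (fun k => hb _)).1
  have h3 : (1 : ℝ) ≤ b 0 := by exact_mod_cast hb 0
  have h4 : 0 < tail q (fun k => b (k + 1)) := by linarith
  refine tendsto_nhds_unique ((tendsto_tailApprox hq hb).comp (tendsto_add_atTop_nat 1)) ?_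
  have h5 : (b 0 : ℝ) + 1 / tail q (fun k => b (k + 1)) ≠ 0 := by positivity
  have := (tendsto_const_nhds (x := (q : ℝ))).add ((tendsto_const_nhds (x := (1 : ℝ))).div
    ((tendsto_const_nhds (x := (b 0 : ℝ))).add
      ((tendsto_const_nhds (x := (1 : ℝ))).div h1 h4.ne')) h5)
  exact this

/-- The denominators (or numerators) of the `k`-th convergents from below and from above, under the
recursion with partial quotients `q, b₀, q, b₁, …` started at `(x, y)`. -/
def convergentPair {A : Type*} [Semiring A] (q : ℕ) (b : ℕ → ℕ) (x y : A) : ℕ → A × A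
  | 0 => (x, y)
  | k + 1 =>
    let z := convergentPair q b x y k
    (q * z.2 + z.1, b k * (q * z.2 + z.1) + z.2)

lemma convergentPair_succ_fst {A : Type*} [Semiring A] (q : ℕ) (b : ℕ → ℕ) (x y : A) (k : ℕ) :
    (convergentPair q b x y (k + 1)).1 =
      q * (convergentPair q b x y k).2 + (convergentPair q b x y k).1 := rfl

lemma convergentPair_succ_snd {A : Type*} [Semiring A] (q : ℕ) (b : ℕ → ℕ) (x y : A) (k : ℕ) :
    (convergentPair q b x y (k + 1)).2 =
      b k * (convergentPair q b x y (k + 1)).1 + (convergentPair q b x y k).2 := rfl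

lemma convergentPair_congr {A : Type*} [Semiring A] (q : ℕ) {b b' : ℕ → ℕ} (x y : A) {k : ℕ}
    (h : ∀ i < k, b i = b' i) : convergentPair q b x y k = convergentPair q b' x y k := by
  induction k with
  | zero => rfl
  | succ k ih =>
    simp only [convergentPair]
    rw [ih fun i hi => h i (by omega), h k (by omega)]

/-- The number whose continued fraction starts with the approximations `P/Q < S/R` and continues
with the partial quotients `q, b₀, q, b₁, …`. -/
noncomputable def boundedPoint (q : ℕ) (Q R : ℕ) (P S : ℤ) (b : ℕ → ℕ) : ℝ :=
  (P + tail q b * S) / (Q + tail q b * R)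

section boundedPoint

variable {q Q R : ℕ} {P S : ℤ} {b : ℕ → ℕ}


lemma convergentPair_det (hdet : S * Q - P * R = 1) (k : ℕ) :
    (convergentPair q b P S k).2 * ((convergentPair q b Q R k).1 : ℤ) -
      (convergentPair q b P S k).1 * ((convergentPair q b Q R k).2 : ℤ) = 1 := by
  induction k with
  | zero => simpa [convergentPair] using hdet
  | succ k ih =>
    rw [convergentPair_succ_snd, convergentPair_succ_snd, convergentPair_succ_fst,
      convergentPair_succ_fst]
    push_cast
    linear_combination ih

lemma convergentPair_pos (hQ : 0 < Q) (hQR : Q ≤ R) (hb : ∀ k, 0 < b k) (k : ℕ) :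
    0 < (convergentPair q b Q R k).1 ∧
      (convergentPair q b Q R k).1 ≤ (convergentPair q b Q R k).2 := by
  induction k with
  | zero => exact ⟨hQ, hQR⟩
  | succ k ih =>
    rw [convergentPair_succ_snd]
    have h1 := Nat.le_mul_of_pos_left (convergentPair q b Q R (k + 1)).1 (hb k)
    refine ⟨?_, by simpa using h1.trans (Nat.le_add_right _ _)⟩
    rw [convergentPair_succ_fst]
    omega

lemma convergentPair_dvd (hqQ : q ∣ Q) (k : ℕ) : q ∣ (convergentPair q b Q R k).1 := by
  induction k with
  | zero => exact hqQ
  | succ k ih =>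
    rw [convergentPair_succ_fst]
    exact dvd_add (Dvd.intro _ rfl) ih

/-- The quotient of the errors of the `k`-th pair of convergents is the `k`-th tail of the continued
fraction. -/
lemma convergentPair_theta (hq : 0 < q) (hQ : 0 < Q) (hQR : Q ≤ R) (hb : ∀ k, 0 < b k)
    (hdet : S * Q - P * R = 1) (k : ℕ) :
    let α := boundedPoint q Q R P S b
    ((convergentPair q b Q R k).1 : ℝ) * α - (convergentPair q b P S k).1 =
      tail q (fun i => b (i + k)) *
        ((convergentPair q b P S k).2 - ((convergentPair q b Q R k).2 : ℝ) * α) ∧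
    0 < (convergentPair q b P S k).2 - ((convergentPair q b Q R k).2 : ℝ) * α := by
  intro α
  have hq' : (0 : ℝ) < q := by exact_mod_cast hq
  have hQ' : (0 : ℝ) < Q := by exact_mod_cast hQ
  have hR' : (0 : ℝ) < R := by exact_mod_cast hQ.trans_le hQR
  induction k with
  | zero =>
    have ht : 0 < tail q b := hq'.trans_le (tail_mem hq hb).1
    have hdet' : (S : ℝ) * Q - P * R = 1 := by exact_mod_cast hdet
    have hpos : 0 < (Q : ℝ) + tail q b * R := by positivity
    have hα : α * (Q + tail q b * R) = P + tail q b * S := div_mul_cancel₀ _ hpos.ne'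
    simp only [convergentPair, add_zero]
    constructor
    · linear_combination hα
    · have : ((S : ℝ) - R * α) * (Q + tail q b * R) = 1 := by
        linear_combination hdet' - R * hα
      exact pos_of_mul_pos_left (this ▸ one_pos) hpos.le
  | succ k ih =>
    obtain ⟨h1, h2⟩ := ih
    have hbk : ∀ i, 0 < b (i + k) := fun i => hb _
    have ht := tail_eq hq hbk
    have e : (fun i => b (i + 1 + k)) = fun i => b (i + (k + 1)) := by
      funext i; congr 1; omega
    simp only [zero_add, e] at ht
    have ht' : 0 < tail q (fun i => b (i + (k + 1))) :=
      hq'.trans_le (tail_mem hq (fun i => hb _)).1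
    rw [ht] at h1
    rw [convergentPair_succ_snd, convergentPair_succ_snd, convergentPair_succ_fst,
      convergentPair_succ_fst]
    push_cast
    generalize tail q (fun i => b (i + (k + 1))) = τ at *
    generalize ((convergentPair q b Q R k).1 : ℝ) = x at *
    generalize ((convergentPair q b Q R k).2 : ℝ) = y at *
    generalize ((convergentPair q b P S k).1 : ℝ) = x' at *
    generalize ((convergentPair q b P S k).2 : ℝ) = y' at *
    have hbk' : (0 : ℝ) < b k := by exact_mod_cast hb k
    obtain ⟨η, hη⟩ : ∃ η, η = y' - y * α := ⟨_, rfl⟩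
    rw [← hη] at h1 h2
    have hθ : (q * y + x) * α - (q * y' + x') = η / (b k + 1 / τ) := by
      have : (q * y + x) * α - (q * y' + x') = x * α - x' - q * η := by rw [hη]; ring
      rw [this, h1]; ring
    have hη' : (b k * (q * y' + x') + y') - (b k * (q * y + x) + y) * α =
        η / (b k + 1 / τ) / τ := by
      have : (b k * (q * y' + x') + y') - (b k * (q * y + x) + y) * α =
        η - b k * (η / (b k + 1 / τ)) := by rw [← hθ, hη]; ring
      rw [this]
      field_simp
      ring
    refine ⟨?_, ?_⟩
    · rw [hθ, hη']; field_simp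
    · rw [hη']; positivity

lemma boundedPoint_approxPair (hq : 0 < q) (hqQ : q ∣ Q) (hQ : 0 < Q) (hQR : Q ≤ R)
    (hb : ∀ k, 0 < b k) (hdet : S * Q - P * R = 1) (k : ℕ) :
    ApproxPair q (boundedPoint q Q R P S b) (convergentPair q b Q R k).1
      (convergentPair q b Q R k).2 (convergentPair q b P S k).1 (convergentPair q b P S k).2 := by
  have h := convergentPair_theta hq hQ hQR hb hdet
  obtain ⟨h1, h2⟩ := h k
  obtain ⟨h3, h4⟩ := h (k + 1)
  have hq' : (0 : ℝ) < q := by exact_mod_cast hq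
  have ht : 0 < tail q (fun i => b (i + k)) := hq'.trans_le (tail_mem hq (fun i => hb _)).1
  have ht' : 0 < tail q (fun i => b (i + (k + 1))) := hq'.trans_le (tail_mem hq (fun i => hb _)).1
  have h5 := convergentPair_pos (q := q) hQ hQR hb k
  have h6 : 0 < ((convergentPair q b Q R (k + 1)).1 : ℝ) * boundedPoint q Q R P S b -
      (convergentPair q b P S (k + 1)).1 := by rw [h3]; positivity
  have h7 : (1 : ℝ) ≤ b k := by exact_mod_cast hb k
  rw [convergentPair_succ_snd, convergentPair_succ_snd] at h4
  rw [convergentPair_succ_fst, convergentPair_succ_fst] at h4 h6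
  push_cast at h4 h6
  refine ⟨convergentPair_det hdet k, convergentPair_dvd hqQ k, h5.1, h5.2, ?_, h2, ?_, ?_⟩
  · rw [h1]; positivity
  · linarith
  · nlinarith

lemma boundedPoint_bddAbove {p : ℕ} (hp : 0 < p) (hpq : p < q) (hqQ : q ∣ Q) (hQ : 0 < Q)
    (hQR : Q ≤ R) (hb : ∀ k, 0 < b k) (hdet : S * Q - P * R = 1) :
    BddAbove (Set.range (discrepancy (boundedPoint q Q R P S b) (p / q : ℝ))) :=
  bddAbove_of_chain hp hpq
    (fun k => boundedPoint_approxPair (hp.trans hpq) hqQ hQ hQR hb hdet k)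
    (fun k => convergentPair_succ_fst q b Q R k)
    (fun k => by rw [convergentPair_succ_snd]; exact Nat.le_add_left _ _)

lemma lt_convergentPair_snd (hQ : 0 < Q) (hQR : Q ≤ R) (hb : ∀ k, 0 < b k) (k : ℕ) :
    k < (convergentPair q b Q R k).2 := by
  induction k with
  | zero => exact hQ.trans_le hQR
  | succ k ih =>
    rw [convergentPair_succ_snd]
    have h1 := Nat.mul_pos (hb k) (convergentPair_pos (q := q) hQ hQR hb (k + 1)).1
    simp only [Nat.cast_id]
    omega

/-- Multiplying a rational number by a denominator gives an error that is an integer multiple of a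
fixed positive number, so it cannot be positive and tend to `0`. -/
lemma boundedPoint_irrational (hq : 0 < q) (hqQ : q ∣ Q) (hQ : 0 < Q)
    (hQR : Q ≤ R) (hb : ∀ k, 0 < b k) (hdet : S * Q - P * R = 1) :
    Irrational (boundedPoint q Q R P S b) := by
  rintro ⟨r, hr⟩
  have h := boundedPoint_approxPair hq hqQ hQ hQR hb hdet r.den
  have hk := lt_convergentPair_snd (q := q) hQ hQR hb r.den
  have h1 := h.left_pos
  have h2 := h.right_pos
  have h3 := h.det_theta
  rw [← hr] at h1 h2 h3
  set x := (convergentPair q b Q R r.den).1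
  set y := (convergentPair q b Q R r.den).2
  set x' := (convergentPair q b P S r.den).1
  have hd : (0 : ℝ) < r.den := by exact_mod_cast r.den_pos
  have hrd : (r.den : ℝ) * r = r.num := by exact_mod_cast Rat.den_mul_eq_num r
  have h4 : (0 : ℝ) < x * r.num - x' * r.den := by
    have : (x : ℝ) * r.num - x' * r.den = r.den * (x * r - x') := by rw [← hrd]; ring
    rw [this]; positivity
  have h5 : (0 : ℤ) < x * r.num - x' * r.den := by exact_mod_cast h4
  have h6 : (1 : ℝ) ≤ x * r.num - x' * r.den := by exact_mod_cast h5
  have h7 : (1 : ℝ) ≤ r.den * (x * r - x') := by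
    have : (x : ℝ) * r.num - x' * r.den = r.den * (x * r - x') := by rw [← hrd]; ring
    linarith
  have h8 : (r.den : ℝ) < y := by exact_mod_cast hk
  have h9 : 0 < (x : ℝ) := by exact_mod_cast h.pos
  nlinarith [mul_pos h9 h2, mul_lt_mul_of_pos_right h8 h1]

end boundedPoint

lemma boundedPoint_mem {p q Q R : ℕ} {P S : ℤ} {b : ℕ → ℕ} (hp : 0 < p) (hpq : p < q)
    (hqQ : q ∣ Q) (hQ : 0 < Q) (hQR : Q ≤ R) (hb : ∀ k, 0 < b k) (hdet : S * Q - P * R = 1) :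
    boundedPoint q Q R P S b ∈ oneSideBoundedSet (p / q : ℝ) :=
  ⟨boundedPoint_irrational (hp.trans hpq) hqQ hQ hQR hb hdet,
    Or.inl (boundedPoint_bddAbove hp hpq hqQ hQ hQR hb hdet)⟩

/-! ### Density -/

/-- Near `x > 0` there is a reduced fraction whose denominator is a large power of `q`, and it can be
taken as the beginning of a continued fraction of bounded discrepancy. -/
lemma Ioi_subset_closure {p q : ℕ} (hp : 0 < p) (hpq : p < q) :
    Set.Ioi (0 : ℝ) ⊆ closure (oneSideBoundedSet (p / q : ℝ) ∩ Set.Ioi (0 : ℝ)) := by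
  intro x hx
  rw [Set.mem_Ioi] at hx
  rw [Metric.mem_closure_iff]
  intro ε hε
  have hq1 : 1 < q := by omega
  have hq : 0 < q := by omega
  have hq' : (1 : ℝ) < q := by exact_mod_cast hq1
  obtain ⟨n, hn⟩ := pow_unbounded_of_one_lt ((q + 2) / min ε x) hq'
  have hm : 0 < min ε x := lt_min hε hx
  rw [div_lt_iff₀ hm] at hn
  set Q := q ^ (n + 1) with hQ
  have hQ0 : 0 < Q := by positivity
  have hQ' : (0 : ℝ) < Q := by exact_mod_cast hQ0
  have hnQ : (q : ℝ) ^ n ≤ Q := by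
    rw [hQ]; push_cast; exact pow_le_pow_right₀ hq'.le (Nat.le_succ n)
  set u := ⌊x * Q / q⌋ with hu
  set P : ℤ := 1 + q * u with hP
  have hcop : IsCoprime P (Q : ℤ) := by
    rw [hQ]
    push_cast
    apply IsCoprime.pow_right
    exact ⟨1, -u, by rw [hP]; ring⟩
  obtain ⟨s, t, hst⟩ := hcop
  -- The denominator `R` of the other neighbour is `≡ -P⁻¹` modulo `Q` and may be taken `≥ Q`.
  obtain ⟨R, hR⟩ : ∃ R : ℕ, (R : ℤ) = Q + (-s) % Q :=
    ⟨(Q + (-s) % Q).toNat, Int.toNat_of_nonneg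
      (add_nonneg (by positivity) (Int.emod_nonneg _ (by positivity)))⟩
  have hQR : Q ≤ R := by
    have := Int.emod_nonneg (-s) (show (Q : ℤ) ≠ 0 by positivity)
    omega
  have hR2 := Int.mul_ediv_add_emod (-s) (Q : ℤ)
  set S : ℤ := t + P * (1 - (-s) / Q) with hS
  have hdet : S * Q - P * R = 1 := by
    rw [hS, hR]
    linear_combination hst - P * hR2
  have hb : ∀ k : ℕ, 0 < (fun _ => 1 : ℕ → ℕ) k := fun _ => Nat.one_pos
  have hmem := boundedPoint_mem hp hpq (hQ ▸ dvd_pow_self q (Nat.succ_ne_zero n)) hQ0 hQR hb hdet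
  have hpair := boundedPoint_approxPair hq (hQ ▸ dvd_pow_self q (Nat.succ_ne_zero n)) hQ0 hQR hb
    hdet 0
  set α := boundedPoint q Q R P S (fun _ => 1)
  have h1 := hpair.left_pos
  have h2 := hpair.right_pos
  have h3 := hpair.det_theta
  simp only [convergentPair] at h1 h2 h3
  have hR' : (Q : ℝ) ≤ R := by exact_mod_cast hQR
  have hQ1 : (1 : ℝ) ≤ Q := by exact_mod_cast hQ0
  have hαP : (Q : ℝ) * α - P < 1 := by
    nlinarith [mul_pos hQ' h2]
  have hu1 := Int.floor_le (x * Q / q)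
  have hu2 := Int.lt_floor_add_one (x * Q / q)
  rw [← hu] at hu1 hu2
  rw [le_div_iff₀ (by linarith)] at hu1
  rw [div_lt_iff₀ (by linarith)] at hu2
  have hPr : (P : ℝ) = 1 + q * u := by rw [hP]; push_cast; ring
  have hdist : Q * |x - α| < q + 2 := by
    have : (Q : ℝ) * |x - α| = |Q * (x - α)| := by rw [abs_mul, abs_of_pos hQ']
    rw [this, abs_lt]
    constructor <;> nlinarith
  have hlt : |x - α| < min ε x := by
    have : Q * |x - α| < Q * min ε x := by nlinarith
    exact lt_of_mul_lt_mul_left this hQ'.le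
  refine ⟨α, ⟨hmem, ?_⟩, ?_⟩
  · have := (abs_lt.1 (hlt.trans_le (min_le_right _ _))).2
    rw [Set.mem_Ioi]; linarith
  · rw [Real.dist_eq]
    exact hlt.trans_le (min_le_left _ _)

/-! ### Positive Hausdorff dimension -/

/-- The points `boundedPoint` whose free partial quotients are `1` or `2`, as binary digits. -/
noncomputable def cantorPoint (q : ℕ) (d : ℕ → Fin 2) : ℝ :=
  boundedPoint q q (2 * q - 1) 1 2 (fun k => (d k : ℕ) + 1)

/-- Two codes that first differ at place `k` share the convergents up to there, whose denominators
grow at most geometrically in `k`. -/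
lemma cantorPoint_separated {q : ℕ} (hq : 2 ≤ q) {d d' : ℕ → Fin 2} {k : ℕ}
    (h : ∀ i < k, d i = d' i) (hk : d k ≠ d' k) :
    1 / (6 * (q + 2) ^ 2 * (2 * q) ^ 2 * ((2 * q + 3) ^ 2) ^ k : ℝ) ≤
      |cantorPoint q d - cantorPoint q d'| := by
  wlog hlt : d k < d' k generalizing d d'
  · rw [abs_sub_comm]
    exact this (fun i hi => (h i hi).symm) hk.symm (lt_of_le_of_ne (not_lt.1 hlt) hk.symm)
  have h0 : (d k : ℕ) = 0 ∧ (d' k : ℕ) = 1 := by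
    have := (d' k).isLt
    have : (d k : ℕ) < d' k := hlt
    omega
  have hq0 : 0 < q := by omega
  have hq' : (2 : ℝ) ≤ q := by exact_mod_cast hq
  set b : ℕ → ℕ := fun k => (d k : ℕ) + 1 with hbd
  set b' : ℕ → ℕ := fun k => (d' k : ℕ) + 1 with hbd'
  have hb : ∀ i, 0 < b i := fun i => Nat.succ_pos _
  have hb' : ∀ i, 0 < b' i := fun i => Nat.succ_pos _
  have hQR : q ≤ 2 * q - 1 := by omega
  have hdet : (2 : ℤ) * (q : ℕ) - 1 * ((2 * q - 1 : ℕ) : ℤ) = 1 := by omega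
  have hbb : ∀ i < k, b i = b' i := fun i hi => by rw [hbd, hbd']; simp only; rw [h i hi]
  obtain ⟨e1, e2⟩ := convergentPair_theta hq0 hq0 hQR hb hdet k
  obtain ⟨e3, e4⟩ := convergentPair_theta hq0 hq0 hQR hb' hdet k
  have hdk := convergentPair_det (q := q) (b := b) hdet k
  rw [← convergentPair_congr q q (2 * q - 1) hbb] at e3 e4
  rw [← convergentPair_congr q (1 : ℤ) 2 hbb] at e3 e4
  have hpos := convergentPair_pos (q := q) hq0 hQR hb k
  have hgrow : ∀ k, ((convergentPair q b q (2 * q - 1) k).2 : ℝ) ≤ 2 * q * (2 * q + 3) ^ k := by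
    intro k
    induction k with
    | zero =>
      have : ((2 * q - 1 : ℕ) : ℝ) ≤ (2 * q : ℕ) := by exact_mod_cast Nat.sub_le _ _
      simpa [convergentPair] using this
    | succ k ih =>
      rw [convergentPair_succ_snd, convergentPair_succ_fst]
      push_cast
      have hp := (convergentPair_pos (q := q) hq0 hQR hb k).2
      have hp' : ((convergentPair q b q (2 * q - 1) k).1 : ℝ) ≤
        (convergentPair q b q (2 * q - 1) k).2 := by exact_mod_cast hp
      have hbk : (b k : ℝ) ≤ 2 := by
        have := (d k).isLt
        have : b k ≤ 2 := by rw [hbd]; simp only; omega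
        exact_mod_cast this
      generalize ((convergentPair q b q (2 * q - 1) k).1 : ℝ) = x at *
      have hy0 : (0 : ℝ) ≤ ((convergentPair q b q (2 * q - 1) k).2 : ℝ) := by positivity
      generalize ((convergentPair q b q (2 * q - 1) k).2 : ℝ) = y at *
      have h1 : (b k : ℝ) * (q * y + x) ≤ 2 * (q * y + y) := by
        have : (0 : ℝ) ≤ b k := by positivity
        have : (0 : ℝ) ≤ q * y + y := by positivity
        calc (b k : ℝ) * (q * y + x) ≤ b k * (q * y + y) := by gcongr
          _ ≤ 2 * (q * y + y) := by gcongr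
      calc (b k : ℝ) * (q * y + x) + y ≤ (2 * q + 3) * y := by linarith
        _ ≤ (2 * q + 3) * (2 * q * (2 * q + 3) ^ k) := by gcongr
        _ = _ := by ring
  have hgk := hgrow k
  -- The tails start with the digits `q, 1` and `q, 2`, which keeps them at least `1/6` apart.
  have ht := tail_eq hq0 (b := fun i => b (i + k)) (fun i => hb _)
  have ht' := tail_eq hq0 (b := fun i => b' (i + k)) (fun i => hb' _)
  have hs := tail_mem hq0 (b := fun i => b (i + 1 + k)) (fun i => hb _)
  have hs' := tail_mem hq0 (b := fun i => b' (i + 1 + k)) (fun i => hb' _)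
  have hm := tail_mem hq0 (b := fun i => b (i + k)) (fun i => hb _)
  have hm' := tail_mem hq0 (b := fun i => b' (i + k)) (fun i => hb' _)
  have hbk : b (0 + k) = 1 := by rw [hbd]; simp only [zero_add]; omega
  have hbk' : b' (0 + k) = 2 := by rw [hbd']; simp only [zero_add]; omega
  simp only [hbk, hbk'] at ht ht'
  have hsep : 1 / 6 ≤ tail q (fun i => b (i + k)) - tail q (fun i => b' (i + k)) := by
    generalize tail q (fun i => b (i + 1 + k)) = t at *
    generalize tail q (fun i => b' (i + 1 + k)) = t' at *
    have ht0 : 0 < t := by linarith [hs.1]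
    have ht0' : 0 < t' := by linarith [hs'.1]
    have g1 : (2 : ℝ) / 3 ≤ 1 / (((1 : ℕ) : ℝ) + 1 / t) := by
      rw [le_div_iff₀ (by positivity)]
      have : 1 / t ≤ 1 / 2 := one_div_le_one_div_of_le (by norm_num) (by linarith [hs.1])
      push_cast; linarith
    have g2 : 1 / (((2 : ℕ) : ℝ) + 1 / t') ≤ 1 / 2 := by
      apply one_div_le_one_div_of_le (by norm_num)
      have : 0 < 1 / t' := by positivity
      push_cast; linarith
    rw [ht, ht']; linarith
  change 1 / _ ≤ |boundedPoint q q (2 * q - 1) 1 2 b - boundedPoint q q (2 * q - 1) 1 2 b'|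
  generalize boundedPoint q q (2 * q - 1) 1 2 b = α at *
  generalize boundedPoint q q (2 * q - 1) 1 2 b' = α' at *
  generalize tail q (fun i => b (i + k)) = τ at *
  generalize tail q (fun i => b' (i + k)) = τ' at *
  have hdk' : ((convergentPair q b (1 : ℤ) 2 k).2 : ℝ) *
      ((convergentPair q b q (2 * q - 1) k).1 : ℝ) - ((convergentPair q b (1 : ℤ) 2 k).1 : ℝ) *
      ((convergentPair q b q (2 * q - 1) k).2 : ℝ) = 1 := by exact_mod_cast hdk
  have hx0 : (0 : ℝ) < (convergentPair q b q (2 * q - 1) k).1 := by exact_mod_cast hpos.1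
  have hxy : ((convergentPair q b q (2 * q - 1) k).1 : ℝ) ≤
    (convergentPair q b q (2 * q - 1) k).2 := by exact_mod_cast hpos.2
  generalize ((convergentPair q b (1 : ℤ) 2 k).1 : ℝ) = x' at *
  generalize ((convergentPair q b (1 : ℤ) 2 k).2 : ℝ) = y' at *
  generalize ((convergentPair q b q (2 * q - 1) k).1 : ℝ) = x at *
  generalize ((convergentPair q b q (2 * q - 1) k).2 : ℝ) = y at *
  have hτ : 0 < τ := by linarith [hm.1]
  have hτ' : 0 < τ' := by linarith [hm'.1]
  have hy0 : 0 < y := by linarith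
  have hD : 0 < x + τ * y := by positivity
  have hD' : 0 < x + τ' * y := by positivity
  have hα : α = (x' + τ * y') / (x + τ * y) := by
    rw [eq_div_iff hD.ne']; linear_combination e1
  have hα' : α' = (x' + τ' * y') / (x + τ' * y) := by
    rw [eq_div_iff hD'.ne']; linear_combination e3
  have hdiff : α - α' = (τ - τ') / ((x + τ * y) * (x + τ' * y)) := by
    rw [hα, hα', div_sub_div _ _ hD.ne' hD'.ne']
    congr 1
    linear_combination (τ - τ') * hdk'
  have hB : x + τ * y ≤ (q + 2) * (2 * q * (2 * q + 3) ^ k) := by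
    calc x + τ * y ≤ y + (q + 1) * y := by
          have := mul_le_mul_of_nonneg_right hm.2 hy0.le
          linarith
      _ = (q + 2) * y := by ring
      _ ≤ _ := by gcongr
  have hB' : x + τ' * y ≤ (q + 2) * (2 * q * (2 * q + 3) ^ k) := by
    calc x + τ' * y ≤ y + (q + 1) * y := by
          have := mul_le_mul_of_nonneg_right hm'.2 hy0.le
          linarith
      _ = (q + 2) * y := by ring
      _ ≤ _ := by gcongr
  refine le_trans ?_ (le_abs_self _)
  rw [hdiff]
  calc 1 / (6 * (q + 2) ^ 2 * (2 * q) ^ 2 * ((2 * q + 3) ^ 2) ^ k : ℝ)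
      = (1 / 6) / (((q + 2) * (2 * q * (2 * q + 3) ^ k)) *
          ((q + 2) * (2 * q * (2 * q + 3) ^ k))) := by
        rw [← pow_mul, mul_comm 2 k, pow_mul]
        field_simp
    _ ≤ (τ - τ') / ((x + τ * y) * (x + τ' * y)) := by gcongr

lemma exists_first_difference {d d' : ℕ → Fin 2} (h : d ≠ d') :
    ∃ k, (∀ i < k, d i = d' i) ∧ d k ≠ d' k := by
  classical
  have h1 : ∃ k, d k ≠ d' k := Function.ne_iff.1 h
  exact ⟨Nat.find h1, fun i hi => not_not.1 (Nat.find_min h1 hi), Nat.find_spec h1⟩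

lemma cantorPoint_injective {q : ℕ} (hq : 2 ≤ q) : Function.Injective (cantorPoint q) := by
  intro d d' hdd
  by_contra hne
  obtain ⟨k, hk, hk'⟩ := exists_first_difference hne
  have := cantorPoint_separated hq hk hk'
  rw [hdd, sub_self, abs_zero] at this
  have h2 : (0 : ℝ) < 1 / (6 * (q + 2) ^ 2 * (2 * q) ^ 2 * ((2 * q + 3) ^ 2) ^ k : ℝ) := by
    have : (0 : ℝ) < q := by exact_mod_cast (show 0 < q by omega)
    positivity
  linarith

/-- The inverse of the coding, followed by the reading of the binary digits, is a Hölder map of the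
coded set onto `[0, 1]`. -/
lemma dimH_range_cantorPoint_pos {q : ℕ} (hq : 2 ≤ q) :
    0 < dimH (Set.range (cantorPoint q)) := by
  have hinj := cantorPoint_injective hq
  have hq0 : (0 : ℝ) < q := by exact_mod_cast (show 0 < q by omega)
  obtain ⟨f, hf⟩ : ∃ f : ℝ → ℝ, ∀ d, f (cantorPoint q d) = Real.ofDigits d :=
    ⟨fun x => Real.ofDigits (Function.invFun (cantorPoint q) x), fun d => by
      beta_reduce
      rw [Function.leftInverse_invFun hinj d]⟩
  -- The Hölder exponent is `1/m`, with `m` such that `2 ^ m` exceeds the contraction rate `Λ`.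
  set Λ : ℝ := (2 * q + 3) ^ 2 with hΛ
  obtain ⟨m, hm⟩ := pow_unbounded_of_one_lt Λ (show (1 : ℝ) < 2 by norm_num)
  have hΛ1 : 1 < Λ := by rw [hΛ]; nlinarith
  have hm0 : m ≠ 0 := by
    rintro rfl
    rw [pow_zero] at hm
    linarith
  set K : ℝ := 6 * (q + 2) ^ 2 * (2 * q) ^ 2 with hK
  have hK0 : 0 < K := by positivity
  have hbound : ∀ d d', |Real.ofDigits d - Real.ofDigits d'| ^ m ≤
      K * |cantorPoint q d - cantorPoint q d'| := by
    intro d d'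
    by_cases hne : d = d'
    · subst hne; simp [hm0]
    · obtain ⟨k, hk, hk'⟩ := exists_first_difference hne
      have h1 := cantorPoint_separated hq hk hk'
      have h2 := Real.abs_ofDigits_sub_ofDigits_le hk
      calc |Real.ofDigits d - Real.ofDigits d'| ^ m ≤ ((((2 : ℕ) : ℝ) ^ k)⁻¹) ^ m := by gcongr
        _ = ((2 ^ m) ^ k)⁻¹ := by push_cast; rw [inv_pow, ← pow_mul, ← pow_mul, mul_comm]
        _ ≤ (Λ ^ k)⁻¹ := by gcongr
        _ = K * (1 / (K * Λ ^ k)) := by field_simp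
        _ ≤ _ := by gcongr
  have hH : HolderOnWith (Real.toNNReal (K ^ (1 / m : ℝ))) (1 / m : NNReal) f
      (Set.range (cantorPoint q)) := by
    rintro _ ⟨d, rfl⟩ _ ⟨d', rfl⟩
    rw [hf, hf, edist_dist, edist_dist, Real.dist_eq, Real.dist_eq]
    rw [show ((Real.toNNReal (K ^ (1 / m : ℝ)) : NNReal) : ENNReal) =
      ENNReal.ofReal (K ^ (1 / m : ℝ)) from rfl]
    have he : (((1 / m : NNReal)) : ℝ) = 1 / m := by push_cast; rfl
    rw [he, ENNReal.ofReal_rpow_of_nonneg (abs_nonneg _) (by positivity),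
      ← ENNReal.ofReal_mul (by positivity), ← Real.mul_rpow hK0.le (abs_nonneg _)]
    apply ENNReal.ofReal_le_ofReal
    have h3 := Real.rpow_le_rpow (by positivity) (hbound d d') (show (0 : ℝ) ≤ 1 / m by positivity)
    rwa [one_div, Real.pow_rpow_inv_natCast (abs_nonneg _) hm0, ← one_div] at h3
  have hm' : (0 : NNReal) < 1 / m := by positivity
  have hdim := hH.dimH_image_le hm'
  have himg : Set.Icc (0 : ℝ) 1 ⊆ f '' Set.range (cantorPoint q) := by
    intro y hy
    obtain ⟨d, -, hd⟩ := Real.ofDigits_SurjOn (b := 2) (by norm_num) hy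
    exact ⟨_, ⟨d, rfl⟩, by rw [hf, hd]⟩
  have h1 : (1 : ENNReal) ≤ dimH (f '' Set.range (cantorPoint q)) := by
    have : dimH (Set.Icc (0 : ℝ) 1) = 1 := by
      rw [← segment_eq_Icc zero_le_one]
      exact Real.dimH_segment zero_ne_one
    rw [← this]
    exact dimH_mono himg
  rw [pos_iff_ne_zero]
  intro h0
  rw [h0] at hdim
  simp only [ENNReal.zero_div] at hdim
  exact absurd (h1.trans hdim) (by norm_num)

lemma dimH_oneSideBoundedSet_pos {p q : ℕ} (hp : 0 < p) (hpq : p < q) :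
    0 < dimH (oneSideBoundedSet (p / q : ℝ)) := by
  refine (dimH_range_cantorPoint_pos (show 2 ≤ q by omega)).trans_le (dimH_mono ?_)
  rintro _ ⟨d, rfl⟩
  exact boundedPoint_mem hp hpq dvd_rfl (by omega) (by omega) (fun _ => Nat.succ_pos _) (by omega)

/-! ### A necessary condition for boundedness from above -/

/-- `Qα - P` is positive and less than `1/(4qQ)`, where `P/Q` is a reduced fraction whose
denominator is not a multiple of `q`. -/
structure IsCloseBelow (q : ℕ) (α : ℝ) (Q : ℕ) (P : ℤ) : Prop where
  coprime : IsCoprime P (Q : ℤ)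
  not_dvd : ¬ q ∣ Q
  pos : 0 < (Q : ℝ) * α - P
  lt : 4 * q * Q * ((Q : ℝ) * α - P) < 1

/-- The irrational numbers without close approximations from below by reduced fractions of
denominator at least `N` and not divisible by `q`. -/
def avoidingSet (q N : ℕ) : Set ℝ :=
  {α | Irrational α ∧ ∀ Q : ℕ, N ≤ Q → ∀ P : ℤ, ¬ IsCloseBelow q α Q P}

/-- Each close approximation from below of denominator `Q` provides a block of length `Q` over which
the discrepancy grows by at least `1/q`. Longer blocks are placed first, so that they move the
starting point of the shorter ones by very little. -/
lemma exists_large_discrepancy {p q : ℕ} {α : ℝ} (hp : 0 < p) (hpq : p < q)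
    (hcop : Nat.Coprime p q) (h : ∀ N, ∃ Q, N ≤ Q ∧ ∃ P, IsCloseBelow q α Q P) (m : ℕ) :
    ∀ ε : ℝ, 0 < ε → ∃ n : ℕ, Int.fract ((n : ℝ) * α) < ε ∧
      (m : ℝ) / q ≤ discrepancy α (p / q : ℝ) n := by
  have hq : 0 < q := hp.trans hpq
  have hq' : (0 : ℝ) < q := by exact_mod_cast hq
  have hq1 : (1 : ℝ) ≤ q := by exact_mod_cast hq
  induction m with
  | zero => exact fun ε hε => ⟨0, by simpa using hε, by simp [discrepancy_zero]⟩
  | succ m ih =>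
    intro ε hε
    obtain ⟨N, hN⟩ := exists_nat_gt (1 / ε)
    obtain ⟨Q, hNQ, P, hc⟩ := h (N + 1)
    have hQ : 0 < Q := by omega
    have hQ' : (0 : ℝ) < Q := by exact_mod_cast hQ
    have hθ := hc.pos
    have hθ' := hc.lt
    set θ := (Q : ℝ) * α - P with hθd
    have hθq : θ < 1 / (4 * q * Q) := by
      rw [lt_div_iff₀ (by positivity)]; linarith
    have hθε : θ < ε / 2 := by
      have h1 : 1 / ε < Q := hN.trans (by exact_mod_cast hNQ)
      rw [div_lt_iff₀ hε] at h1
      have : θ * (4 * q * Q) < ε / 2 * (4 * q * Q) := by nlinarith [mul_pos hQ' hε]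
      exact lt_of_mul_lt_mul_right this (by positivity)
    obtain ⟨n, hn1, hn2⟩ := ih (min (ε / 2) (1 / (4 * q * Q))) (by positivity)
    rw [lt_min_iff] at hn1
    have hn0 := Int.fract_nonneg ((n : ℝ) * α)
    have hfr := fract_natCast_mul_div p Q hq
    have hr : 0 < p * Q % q := by
      rcases Nat.eq_zero_or_pos (p * Q % q) with h0 | h0
      · exact absurd (hcop.symm.dvd_of_dvd_mul_left (Nat.dvd_of_mod_eq_zero h0)) hc.not_dvd
      · exact h0
    have hr' : p * Q % q + 1 ≤ q := Nat.mod_lt _ hq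
    have hr1 : (1 : ℝ) ≤ ((p * Q % q : ℕ) : ℝ) := by exact_mod_cast hr
    have hr2 : ((p * Q % q : ℕ) : ℝ) + 1 ≤ q := by exact_mod_cast hr'
    generalize ((p * Q % q : ℕ) : ℝ) = r at *
    have hsmall : (1 : ℝ) / (4 * q * Q) ≤ 1 / 4 := by
      apply one_div_le_one_div_of_le (by norm_num)
      have : (1 : ℝ) ≤ Q := by exact_mod_cast hQ
      nlinarith
    have hfrn : Int.fract (((n + Q : ℕ) : ℝ) * α) = Int.fract ((n : ℝ) * α) + θ := by
      rw [Int.fract_eq_iff]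
      refine ⟨by positivity, by linarith, ⌊(n : ℝ) * α⌋ + P, ?_⟩
      have := Int.floor_add_fract ((n : ℝ) * α)
      push_cast
      linear_combination (-1 : ℝ) * this - hθd
    have hlow := card_hits_lower (α := α) (c := (p / q : ℝ)) (P := P) (m := n) (j₀ := n + Q) hQ
      hc.coprime (by positivity) (by rw [div_lt_one hq']; exact_mod_cast hpq)
      (by rw [Finset.mem_Ioc]; omega) (by
        rw [hfrn, hfr, ← hθd, abs_of_pos hθ]
        have h1 : 4 * ((1 : ℝ) / (4 * q * Q)) = 1 / q / Q := by field_simp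
        have h2 : (1 : ℝ) / q / Q ≤ r / q / Q := by gcongr
        have h3 : (0 : ℝ) < 1 / (4 * q * Q) := by positivity
        linarith)
    refine ⟨n + Q, by rw [hfrn]; linarith, ?_⟩
    have hD := discrepancy_add_sub α (p / q : ℝ) n Q
    have h1 : (⌊(Q : ℝ) * (p / q : ℝ)⌋ : ℝ) + 1 ≤ ((hits α (p / q : ℝ) n (n + Q)).card : ℝ) := by
      exact_mod_cast hlow
    have h2 := Int.floor_add_fract ((Q : ℝ) * (p / q : ℝ))
    have h3 : r / q ≤ 1 - 1 / q := by
      rw [div_le_iff₀ hq']; field_simp; linarith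
    have h4 : ((m + 1 : ℕ) : ℝ) / q = m / q + 1 / q := by push_cast; ring
    rw [h4]
    linarith

lemma exists_mem_avoidingSet {p q : ℕ} {α : ℝ} (hp : 0 < p) (hpq : p < q)
    (hcop : Nat.Coprime p q) (hα : Irrational α)
    (hb : BddAbove (Set.range (discrepancy α (p / q : ℝ)))) : ∃ N, α ∈ avoidingSet q N := by
  by_contra hcon
  have h : ∀ N, ∃ Q, N ≤ Q ∧ ∃ P, IsCloseBelow q α Q P := by
    intro N
    by_contra hN
    push Not at hN
    exact hcon ⟨N, hα, hN⟩
  obtain ⟨M, hM⟩ := hb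
  obtain ⟨m, hm⟩ := exists_nat_gt (M * q)
  obtain ⟨n, -, hn⟩ := exists_large_discrepancy hp hpq hcop h m 1 one_pos
  have hq' : (0 : ℝ) < q := by exact_mod_cast hp.trans hpq
  have h1 := hn.trans (hM ⟨n, rfl⟩)
  rw [div_le_iff₀ hq'] at h1
  linarith

lemma fract_ne_ratCast {α : ℝ} (hα : Irrational α) {j : ℕ} (hj : 0 < j) (r : ℚ) :
    Int.fract ((j : ℝ) * α) ≠ r := by
  intro h
  have h1 : Irrational (Int.fract ((j : ℝ) * α)) := by
    rw [Int.fract]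
    exact (hα.natCast_mul hj.ne').sub_intCast _
  exact h1 ⟨r, h.symm⟩

/-- The reflection `x ↦ -x` exchanges `[0, c)` with the complement of `[0, 1 - c)`, up to the
endpoints, which the orbit of `0` under an irrational rotation avoids. -/
lemma discrepancy_neg {α : ℝ} (hα : Irrational α) (c : ℚ) (n : ℕ) :
    discrepancy (-α) (1 - c : ℝ) n = -discrepancy α (c : ℝ) n := by
  rw [discrepancy_eq_card, discrepancy_eq_card]
  have h1 : hits (-α) (1 - c : ℝ) 0 n =
      (Finset.Ioc 0 n).filter fun j : ℕ => ¬ Int.fract ((j : ℝ) * α) < (c : ℝ) := by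
    unfold hits
    refine Finset.filter_congr fun j hj => ?_
    have hj0 := (Finset.mem_Ioc.1 hj).1
    have h2 := fract_ne_ratCast hα hj0 c
    have h3 : Int.fract ((j : ℝ) * α) ≠ 0 := by simpa using fract_ne_ratCast hα hj0 0
    rw [mul_neg, Int.fract_neg h3, not_lt]
    constructor
    · intro h; linarith
    · intro h; have := lt_of_le_of_ne h h2.symm; linarith
  have h4 := Finset.card_filter_add_card_filter_not (s := Finset.Ioc 0 n)
    (fun j : ℕ => Int.fract ((j : ℝ) * α) < (c : ℝ))
  rw [h1]
  have h5 : (((Finset.Ioc 0 n).filter fun j : ℕ => Int.fract ((j : ℝ) * α) < (c : ℝ)).card : ℝ) +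
      ((Finset.Ioc 0 n).filter fun j : ℕ => ¬ Int.fract ((j : ℝ) * α) < (c : ℝ)).card = n := by
    rw [← Nat.cast_add, h4, Nat.card_Ioc, Nat.sub_zero]
  unfold hits
  linarith

lemma oneSideBoundedSet_subset {p q : ℕ} (hp : 0 < p) (hpq : p < q) (hcop : Nat.Coprime p q) :
    oneSideBoundedSet (p / q : ℝ) ⊆
      (⋃ N, avoidingSet q N) ∪ Neg.neg ⁻¹' (⋃ N, avoidingSet q N) := by
  rintro α ⟨hα, hb | hb⟩
  · exact Or.inl (Set.mem_iUnion.2 (exists_mem_avoidingSet hp hpq hcop hα hb))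
  · refine Or.inr (Set.mem_iUnion.2 (exists_mem_avoidingSet (p := q - p) (by omega) (by omega)
      ((Nat.coprime_self_sub_left hpq.le).2 hcop) hα.neg ?_))
    obtain ⟨M, hM⟩ := hb
    refine ⟨-M, ?_⟩
    rintro _ ⟨n, rfl⟩
    have h1 := discrepancy_neg hα (p / q : ℚ) n
    push_cast at h1
    have hq' : (q : ℝ) ≠ 0 := by
      have : (0 : ℝ) < q := by exact_mod_cast hp.trans hpq
      exact this.ne'
    have h2 : (1 - p / q : ℝ) = ((q - p : ℕ) : ℝ) / q := by
      rw [Nat.cast_sub hpq.le]; field_simp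
    rw [← h2, h1]
    have := hM ⟨n, rfl⟩
    linarith

/-! ### First category -/

lemma isMeagre_avoidingSet {q : ℕ} (hq : 2 ≤ q) (N : ℕ) : IsMeagre (avoidingSet q N) := by
  set U : Set ℝ := {α | ∃ Q : ℕ, N ≤ Q ∧ ∃ P : ℤ, IsCloseBelow q α Q P} with hU
  have hopen : IsOpen U := by
    rw [isOpen_iff_mem_nhds]
    rintro α ⟨Q, hNQ, P, hc⟩
    have h1 : ∀ᶠ β in 𝓝 α, 0 < (Q : ℝ) * β - P :=
      ContinuousAt.eventually_lt (by fun_prop) (by fun_prop) hc.pos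
    have h2 : ∀ᶠ β in 𝓝 α, 4 * q * Q * ((Q : ℝ) * β - P) < 1 :=
      ContinuousAt.eventually_lt (by fun_prop) (by fun_prop) hc.lt
    filter_upwards [h1, h2] with β hβ1 hβ2
    exact ⟨Q, hNQ, P, hc.coprime, hc.not_dvd, hβ1, hβ2⟩
  have hdense : Dense U := by
    rw [Metric.dense_iff]
    intro x ε hε
    obtain ⟨n, hn⟩ := exists_nat_gt (2 / ε)
    obtain ⟨Q, hQ, hprime⟩ := Nat.exists_infinite_primes (N + n + q + 1)
    have hQ0 : 0 < Q := hprime.pos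
    have hQ' : (0 : ℝ) < Q := by exact_mod_cast hQ0
    have hq' : (2 : ℝ) ≤ q := by exact_mod_cast hq
    -- of two consecutive numerators one is prime to `Q`
    obtain ⟨P, hP1, hP2, hPQ⟩ : ∃ P : ℤ, (P : ℝ) ≤ x * Q + 1 ∧ x * Q - 1 ≤ P ∧ ¬ (Q : ℤ) ∣ P := by
      have h1 := Int.floor_le (x * Q)
      have h2 := Int.lt_floor_add_one (x * Q)
      by_cases hd : (Q : ℤ) ∣ ⌊x * Q⌋
      · refine ⟨⌊x * Q⌋ + 1, by push_cast; linarith, by push_cast; linarith, fun hd' => ?_⟩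
        have h3 : (Q : ℤ) ∣ 1 := by simpa using dvd_sub hd' hd
        have h4 : Q ∣ 1 := by exact_mod_cast h3
        exact hprime.one_lt.ne' (Nat.dvd_one.1 h4)
      · exact ⟨⌊x * Q⌋, by linarith, by linarith, hd⟩
    have hcop : IsCoprime P (Q : ℤ) :=
      ((Nat.prime_iff_prime_int.1 hprime).coprime_iff_not_dvd.2 hPQ).symm
    have hnd : ¬ q ∣ Q := by
      intro hd
      rcases (Nat.dvd_prime hprime).1 hd with h | h <;> omega
    have hα : (Q : ℝ) * ((P + 1 / (8 * q * Q)) / Q) - P = 1 / (8 * q * Q) := by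
      field_simp; ring
    refine ⟨(P + 1 / (8 * q * Q)) / Q, ?_, Q, by omega, P, hcop, hnd, ?_, ?_⟩
    · have hQ1 : (1 : ℝ) ≤ Q := by exact_mod_cast hQ0
      have h1 : (1 : ℝ) / (8 * q * Q) ≤ 1 / 2 := by
        apply one_div_le_one_div_of_le (by norm_num)
        nlinarith
      have h0 : (0 : ℝ) < 1 / (8 * q * Q) := by positivity
      have h2 : 2 / ε < Q := hn.trans (by exact_mod_cast (by omega : n < Q))
      rw [div_lt_iff₀ hε] at h2
      rw [Metric.mem_ball, Real.dist_eq, abs_lt]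
      constructor
      · rw [lt_sub_iff_add_lt, lt_div_iff₀ hQ']; nlinarith
      · rw [sub_lt_iff_lt_add, div_lt_iff₀ hQ']; nlinarith
    · rw [hα]; positivity
    · rw [hα]
      have : (4 * q * Q * (1 / (8 * q * Q)) : ℝ) = 1 / 2 := by field_simp; norm_num
      rw [this]; norm_num
  have hres : U ∈ residual ℝ := residual_of_dense_open hopen hdense
  refine IsMeagre.mono (s := Uᶜ) ?_ (by change Uᶜᶜ ∈ _; rwa [compl_compl])
  rintro α ⟨-, hα⟩ ⟨Q, hNQ, P, hc⟩
  exact hα Q hNQ P hc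

lemma isMeagre_oneSideBoundedSet {p q : ℕ} (hp : 0 < p) (hpq : p < q) (hcop : Nat.Coprime p q) :
    IsMeagre (oneSideBoundedSet (p / q : ℝ)) := by
  have h : IsMeagre (⋃ N, avoidingSet q N) :=
    isMeagre_iUnion fun N => isMeagre_avoidingSet (by omega) N
  refine IsMeagre.mono (oneSideBoundedSet_subset hp hpq hcop) (h.union ?_)
  exact h.preimage_of_isOpenMap continuous_neg (Homeomorph.neg ℝ).isOpenMap

/-! ### Sums of powers of lengths of cylinders -/

/-- The length of the interval between `S/R` and `(P+S)/(Q+R)`, where `|SQ - PR| = 1`, as a function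
of the denominators `x = Q` and `y = R`. -/
noncomputable def cylinderLength (x y : ℝ) : ℝ := 1 / (y * (x + y))

lemma cylinderLength_pos {x y : ℝ} (hx : 0 < x) (hy : 0 < y) : 0 < cylinderLength x y := by
  unfold cylinderLength; positivity

lemma cylinderLength_child_ge {x y a : ℝ} (hx : 0 < x) (hxy : x ≤ y) (ha : 0 < a) :
    cylinderLength x y / (a + 1) ^ 2 ≤ cylinderLength y (x + a * y) := by
  have hy : 0 < y := hx.trans_le hxy
  unfold cylinderLength
  rw [div_div]
  apply one_div_le_one_div_of_le (by positivity)
  calc (x + a * y) * (y + (x + a * y)) ≤ ((a + 1) * y) * ((a + 1) * (x + y)) := by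
        apply mul_le_mul _ _ (by positivity) (by positivity)
        · linarith
        · nlinarith [mul_pos ha hx]
    _ = y * (x + y) * (a + 1) ^ 2 := by ring

/-- The proportion of a cylinder occupied by its `i`-th subcylinder (digit `i + 1`), as a function of
the ratio `u` of the denominators. -/
noncomputable def childRatio (u : ℝ) (i : ℕ) : ℝ := (1 + u) / ((i + 1 + u) * (i + 2 + u))

lemma childRatio_pos {u : ℝ} (hu : 0 ≤ u) (i : ℕ) : 0 < childRatio u i := by
  unfold childRatio; positivity

lemma cylinderLength_child_eq {x y : ℝ} (hx : 0 < x) (hy : 0 < y) (i : ℕ) :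
    cylinderLength y (x + (i + 1 : ℝ) * y) = cylinderLength x y * childRatio (x / y) i := by
  unfold cylinderLength childRatio
  have h1 : 0 < x + (i + 1 : ℝ) * y := by positivity
  field_simp
  ring

lemma sum_childRatio {u : ℝ} (hu : 0 ≤ u) (n : ℕ) :
    ∑ i ∈ Finset.range n, childRatio u i = 1 - (1 + u) / (n + 1 + u) := by
  induction n with
  | zero => simp [div_self (show (1 + u) ≠ 0 by positivity)]
  | succ n ih =>
    rw [Finset.sum_range_succ, ih, childRatio]
    push_cast
    have h1 : (n : ℝ) + 1 + u ≠ 0 := by positivity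
    have h2 : (n : ℝ) + 2 + u ≠ 0 := by positivity
    have h3 : (n : ℝ) + 1 + 1 + u ≠ 0 := by positivity
    field_simp
    ring

lemma tsum_childRatio_le {u : ℝ} (hu : 0 ≤ u) :
    ∑' i, ENNReal.ofReal (childRatio u i) ≤ 1 := by
  refine ENNReal.tsum_le_of_sum_range_le fun n => ?_
  rw [← ENNReal.ofReal_sum_of_nonneg fun i _ => (childRatio_pos hu i).le, sum_childRatio hu]
  rw [← ENNReal.ofReal_one]
  apply ENNReal.ofReal_le_ofReal
  have : 0 ≤ (1 + u) / (n + 1 + u) := by positivity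
  linarith

/-- Lowering the exponent from `1` to `1 - ε` costs at most `ε` times the term of a convergent
series that does not depend on `u`. -/
lemma childRatio_rpow_le {u ε : ℝ} (hu : 0 ≤ u) (hu1 : u ≤ 1) (hε : 0 ≤ ε) (hε1 : ε ≤ 1 / 4)
    (i : ℕ) :
    childRatio u i ^ (1 - ε) ≤ childRatio u i + ε * (16 * ((i + 2 : ℕ) : ℝ) ^ (-(3 / 2) : ℝ)) := by
  set r := childRatio u i with hr
  have hr0 : 0 < r := childRatio_pos hu i
  set t : ℝ := ((i + 2 : ℕ) : ℝ) with ht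
  have hti : t = i + 2 := by rw [ht]; push_cast; ring
  have hi : (0 : ℝ) ≤ i := by positivity
  have ht0 : 0 < t := by rw [hti]; positivity
  have h1 : r⁻¹ ≤ t ^ 2 := by
    rw [hr, childRatio, inv_div, div_le_iff₀ (by positivity), hti]
    calc ((i : ℝ) + 1 + u) * (i + 2 + u) ≤ (i + 2) * ((i + 2) * (1 + u)) := by
          apply mul_le_mul _ _ (by positivity) (by positivity)
          · linarith
          · nlinarith
      _ = (i + 2) ^ 2 * (1 + u) := by ring
  have h2 : r ≤ 4 / t ^ 2 := by
    rw [hr, childRatio, div_le_div_iff₀ (by positivity) (by positivity), hti]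
    nlinarith [mul_nonneg hi hu, mul_nonneg hi hi, mul_nonneg (mul_nonneg hi hi) hu,
      mul_nonneg (mul_nonneg hi hi) (sub_nonneg.2 hu1), mul_nonneg hi (sub_nonneg.2 hu1),
      mul_nonneg hu hu]
  have h3 : r ^ (-ε) ≤ 1 + 4 * ε * t ^ (1 / 2 : ℝ) := by
    calc r ^ (-ε) = (r⁻¹) ^ ε := by rw [Real.rpow_neg hr0.le, Real.inv_rpow hr0.le]
      _ ≤ (t ^ 2) ^ ε := by gcongr
      _ = (t ^ (1 / 2 : ℝ)) ^ (4 * ε) := by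
        rw [← Real.rpow_natCast, ← Real.rpow_mul ht0.le, ← Real.rpow_mul ht0.le]
        congr 1; push_cast; ring
      _ = (1 + (t ^ (1 / 2 : ℝ) - 1)) ^ (4 * ε) := by congr 1; ring
      _ ≤ 1 + 4 * ε * (t ^ (1 / 2 : ℝ) - 1) := by
        apply rpow_one_add_le_one_add_mul_self
        · have : 0 ≤ t ^ (1 / 2 : ℝ) := by positivity
          linarith
        · positivity
        · linarith
      _ ≤ 1 + 4 * ε * t ^ (1 / 2 : ℝ) := by nlinarith
  have h4 : t ^ (1 / 2 : ℝ) / t ^ 2 = t ^ (-(3 / 2) : ℝ) := by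
    rw [← Real.rpow_natCast t 2, ← Real.rpow_sub ht0]
    norm_num
  calc r ^ (1 - ε) = r * r ^ (-ε) := by
        rw [sub_eq_add_neg, Real.rpow_add hr0, Real.rpow_one]
    _ ≤ r * (1 + 4 * ε * t ^ (1 / 2 : ℝ)) := by gcongr
    _ = r + r * (4 * ε * t ^ (1 / 2 : ℝ)) := by ring
    _ ≤ r + 4 / t ^ 2 * (4 * ε * t ^ (1 / 2 : ℝ)) := by gcongr
    _ = r + ε * (16 * (t ^ (1 / 2 : ℝ) / t ^ 2)) := by ring
    _ = _ := by rw [h4]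

/-- The sum over the children of a cylinder of the `(1 - ε)`-th powers of the lengths exceeds the power
at the cylinder itself by a factor tending to `1` with `ε`, uniformly over all cylinders. -/
lemma exists_tsum_child_le : ∃ K : ℝ, 0 ≤ K ∧ ∀ ε x y : ℝ, 0 ≤ ε → ε ≤ 1 / 4 → 0 < x → x ≤ y →
    ∑' i : ℕ, ENNReal.ofReal (cylinderLength y (x + (i + 1 : ℝ) * y)) ^ (1 - ε) ≤
      ENNReal.ofReal (1 + ε * K) * ENNReal.ofReal (cylinderLength x y) ^ (1 - ε) := by
  have hsum : Summable fun i : ℕ => 16 * ((i + 2 : ℕ) : ℝ) ^ (-(3 / 2) : ℝ) := by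
    have h1 : Summable fun i : ℕ => (i : ℝ) ^ (-(3 / 2) : ℝ) :=
      Real.summable_nat_rpow.2 (by norm_num)
    exact ((summable_nat_add_iff 2).2 h1).mul_left 16
  have hnn : ∀ i : ℕ, 0 ≤ 16 * ((i + 2 : ℕ) : ℝ) ^ (-(3 / 2) : ℝ) := fun i => by positivity
  refine ⟨∑' i : ℕ, 16 * ((i + 2 : ℕ) : ℝ) ^ (-(3 / 2) : ℝ), tsum_nonneg hnn, ?_⟩
  intro ε x y hε hε1 hx hxy
  have hy : 0 < y := hx.trans_le hxy
  have hu : 0 ≤ x / y := by positivity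
  have hu1 : x / y ≤ 1 := (div_le_one hy).2 hxy
  have hL := cylinderLength_pos hx hy
  have hterm : ∀ i : ℕ, ENNReal.ofReal (cylinderLength y (x + (i + 1 : ℝ) * y)) ^ (1 - ε) ≤
      ENNReal.ofReal (cylinderLength x y) ^ (1 - ε) * (ENNReal.ofReal (childRatio (x / y) i) +
        ENNReal.ofReal ε * ENNReal.ofReal (16 * ((i + 2 : ℕ) : ℝ) ^ (-(3 / 2) : ℝ))) := by
    intro i
    have hr := childRatio_pos hu i
    rw [cylinderLength_child_eq hx hy, ENNReal.ofReal_mul hL.le,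
      ENNReal.mul_rpow_of_nonneg _ _ (by linarith)]
    gcongr
    rw [ENNReal.ofReal_rpow_of_pos hr, ← ENNReal.ofReal_mul hε,
      ← ENNReal.ofReal_add hr.le (mul_nonneg hε (hnn i))]
    exact ENNReal.ofReal_le_ofReal (childRatio_rpow_le hu hu1 hε hε1 i)
  refine (ENNReal.tsum_le_tsum hterm).trans ?_
  rw [ENNReal.tsum_mul_left, ENNReal.tsum_add, ENNReal.tsum_mul_left,
    ← ENNReal.ofReal_tsum_of_nonneg hnn hsum, mul_comm]
  gcongr
  rw [ENNReal.ofReal_add zero_le_one (mul_nonneg hε (tsum_nonneg hnn)), ENNReal.ofReal_one,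
    ENNReal.ofReal_mul hε]
  gcongr
  exact tsum_childRatio_le hu

/-- For exponents close to `1`, leaving out one pair of digits, of bounded size, makes the sum over
the grandchildren of a cylinder at most the value at the cylinder itself. -/
lemma exists_tsum_grandchild_le (B : ℕ) : ∃ s : ℝ, 0 < s ∧ s < 1 ∧ ∀ x y : ℝ, 0 < x → x ≤ y →
    ∀ e : ℕ × ℕ, e.1 ≤ B → e.2 ≤ B →
    ∑' i : ℕ × ℕ, (if i = e then 0 else
      ENNReal.ofReal (cylinderLength (x + (i.1 + 1 : ℝ) * y)
        (y + (i.2 + 1 : ℝ) * (x + (i.1 + 1 : ℝ) * y))) ^ s) ≤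
      ENNReal.ofReal (cylinderLength x y) ^ s := by
  obtain ⟨K, hK0, hK⟩ := exists_tsum_child_le
  set κ : ℝ := 1 / ((B + 2) ^ 2 * (B + 2) ^ 2) with hκ
  have hB : (0 : ℝ) ≤ B := by positivity
  have hκ0 : 0 < κ := by positivity
  have hκ1 : κ ≤ 1 := by
    rw [hκ, div_le_one (by positivity)]
    have : (1 : ℝ) ≤ (B + 2) ^ 2 := by nlinarith
    nlinarith
  set ε : ℝ := min (1 / 4) (κ / (3 * (K + 1))) with hε
  have hε0 : 0 < ε := by positivity
  have hε1 : ε ≤ 1 / 4 := min_le_left _ _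
  have hεK : ε * K ≤ κ / 3 := by
    have h1 : ε ≤ κ / (3 * (K + 1)) := min_le_right _ _
    rw [le_div_iff₀ (by positivity)] at h1
    nlinarith
  have hεK0 : 0 ≤ ε * K := by positivity
  refine ⟨1 - ε, by linarith, by linarith, ?_⟩
  intro x y hx hxy e he1 he2
  have hy : 0 < y := hx.trans_le hxy
  set G := ENNReal.ofReal (cylinderLength x y) ^ (1 - ε) with hG
  have hGtop : G ≠ ∞ := ENNReal.rpow_ne_top_of_nonneg (by linarith) ENNReal.ofReal_ne_top
  set f : ℕ × ℕ → ℝ≥0∞ := fun i => ENNReal.ofReal (cylinderLength (x + (i.1 + 1 : ℝ) * y)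
        (y + (i.2 + 1 : ℝ) * (x + (i.1 + 1 : ℝ) * y))) ^ (1 - ε) with hf
  have hyc : ∀ i : ℕ, y ≤ x + (i + 1 : ℝ) * y := fun i => by
    have : (0 : ℝ) ≤ i * y := by positivity
    linarith
  have hall : ∑' i, f i ≤ ENNReal.ofReal (1 + κ) * G := by
    rw [ENNReal.tsum_prod']
    calc ∑' a : ℕ, ∑' b : ℕ, f (a, b)
        ≤ ∑' a : ℕ, ENNReal.ofReal (1 + ε * K) *
          ENNReal.ofReal (cylinderLength y (x + (a + 1 : ℝ) * y)) ^ (1 - ε) :=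
        ENNReal.tsum_le_tsum fun a => hK ε _ _ hε0.le hε1 hy (hyc a)
      _ ≤ ENNReal.ofReal (1 + ε * K) * (ENNReal.ofReal (1 + ε * K) * G) := by
        rw [ENNReal.tsum_mul_left]
        gcongr
        exact hK ε x y hε0.le hε1 hx hxy
      _ ≤ ENNReal.ofReal (1 + κ) * G := by
        rw [← mul_assoc, ← ENNReal.ofReal_mul (by linarith)]
        gcongr
        nlinarith
  have hexc : ENNReal.ofReal κ * G ≤ f e := by
    have h1 := cylinderLength_child_ge hx hxy (a := (e.1 + 1 : ℝ)) (by positivity)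
    have h2 := cylinderLength_child_ge hy (hyc e.1) (a := (e.2 + 1 : ℝ)) (by positivity)
    have hL := cylinderLength_pos hx hy
    have he1' : (e.1 : ℝ) ≤ B := by exact_mod_cast he1
    have he2' : (e.2 : ℝ) ≤ B := by exact_mod_cast he2
    have h3 : κ * cylinderLength x y ≤ cylinderLength (x + (e.1 + 1 : ℝ) * y)
        (y + (e.2 + 1 : ℝ) * (x + (e.1 + 1 : ℝ) * y)) := by
      refine le_trans ?_ h2
      rw [le_div_iff₀ (by positivity)]
      refine le_trans ?_ h1
      rw [le_div_iff₀ (by positivity), hκ]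
      rw [div_mul_eq_mul_div, one_mul, div_mul_eq_mul_div, div_mul_eq_mul_div,
        div_le_iff₀ (by positivity), mul_assoc]
      gcongr ?_ * (?_ * ?_)
      · gcongr ?_ ^ 2
        linarith
      · gcongr ?_ ^ 2
        linarith
    calc ENNReal.ofReal κ * G ≤ ENNReal.ofReal κ ^ (1 - ε) * G := by
          gcongr
          rw [ENNReal.ofReal_rpow_of_pos hκ0]
          apply ENNReal.ofReal_le_ofReal
          exact Real.self_le_rpow_of_le_one hκ0.le hκ1 (by linarith)
      _ = (ENNReal.ofReal κ * ENNReal.ofReal (cylinderLength x y)) ^ (1 - ε) := by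
          rw [hG, ENNReal.mul_rpow_of_nonneg _ _ (by linarith)]
      _ ≤ f e := by
          rw [← ENNReal.ofReal_mul hκ0.le]
          exact ENNReal.rpow_le_rpow (ENNReal.ofReal_le_ofReal h3) (by linarith)
  -- The excluded term is at least `κ G`, which is all by which the full sum may exceed `G`.
  rw [ENNReal.tsum_eq_add_tsum_ite e, ENNReal.ofReal_add zero_le_one hκ0.le, ENNReal.ofReal_one,
    add_mul, one_mul] at hall
  have h1 := (add_le_add_left hexc _).trans hall
  rw [add_comm] at h1
  have h2 := ENNReal.le_of_add_le_add_right (ENNReal.mul_ne_top ENNReal.ofReal_ne_top hGtop) h1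
  convert h2

/-! ### Hausdorff dimension less than one -/

/-- Two successive convergents `P/Q < S/R`, in terms of numerators and denominators only. The number
they approximate is kept apart, in `cylinder`. -/
structure ValidPair (Q R : ℕ) (P S : ℤ) : Prop where
  det : S * Q - P * R = 1
  pos : 0 < Q
  le : Q ≤ R

/-- The irrational numbers whose continued fraction has `P/Q` and `S/R` as successive convergents,
the first from below and the second from above. -/
def cylinder (Q R : ℕ) (P S : ℤ) : Set ℝ :=
  {α | Irrational α ∧ 0 < S - (R : ℝ) * α ∧ S - (R : ℝ) * α < (Q : ℝ) * α - P}

lemma ValidPair.child {Q R : ℕ} {P S : ℤ} (h : ValidPair Q R P S) (a b : ℕ) :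
    ValidPair (Q + (a + 1) * R) (R + (b + 1) * (Q + (a + 1) * R)) (P + (a + 1) * S)
      (S + (b + 1) * (P + (a + 1) * S)) := by
  refine ⟨?_, by have := h.pos; omega, ?_⟩
  · push_cast
    linear_combination h.det
  · have := Nat.le_mul_of_pos_left (Q + (a + 1) * R) (Nat.succ_pos b)
    exact this.trans (Nat.le_add_left _ _)

lemma irrational_mul_sub {α : ℝ} (hα : Irrational α) {Q : ℕ} (hQ : 0 < Q) (P : ℤ) :
    (Q : ℝ) * α - P ≠ 0 :=
  ((hα.natCast_mul hQ.ne').sub_intCast P).ne_zero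

/-- The division step `s = (k + 1) t + r` with `0 < r < t`, when `t < s` are incommensurable. -/
lemma exists_digit {s t : ℝ} (ht : 0 < t) (hts : t < s) (hne : ∀ k : ℕ, s - (k + 1) * t ≠ 0) :
    ∃ k : ℕ, 0 < s - (k + 1) * t ∧ s - (k + 1) * t < t := by
  have h1 : (1 : ℝ) ≤ s / t := (one_le_div ht).2 hts.le
  have h2 : 1 ≤ ⌊s / t⌋₊ := Nat.le_floor (by simpa using h1)
  have h3 := Nat.floor_le (show 0 ≤ s / t by linarith)
  have h4 := Nat.lt_floor_add_one (s / t)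
  obtain ⟨k, hk⟩ := Nat.exists_eq_add_of_le' h2
  rw [hk] at h3 h4
  push_cast at h3 h4
  rw [le_div_iff₀ ht] at h3
  rw [div_lt_iff₀ ht] at h4
  exact ⟨k, lt_of_le_of_ne (by linarith) (hne k).symm, by linarith⟩

lemma exists_mem_cylinder_child {Q R : ℕ} {P S : ℤ} (h : ValidPair Q R P S) {α : ℝ}
    (hα : α ∈ cylinder Q R P S) :
    ∃ a b : ℕ, α ∈ cylinder (Q + (a + 1) * R) (R + (b + 1) * (Q + (a + 1) * R)) (P + (a + 1) * S)
      (S + (b + 1) * (P + (a + 1) * S)) := by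
  obtain ⟨hirr, hη, hηθ⟩ := hα
  have hQ := h.pos
  obtain ⟨a, ha1, ha2⟩ := exists_digit hη hηθ (fun k => by
    have := irrational_mul_sub hirr (Q := Q + (k + 1) * R) (by omega) (P + (k + 1) * S)
    push_cast at this
    convert this using 1
    ring)
  obtain ⟨b, hb1, hb2⟩ := exists_digit ha1 ha2 (fun k => by
    have := irrational_mul_sub hirr (Q := R + (k + 1) * (Q + (a + 1) * R))
      (by have := h.le; omega) (S + (k + 1) * (P + (a + 1) * S))
    push_cast at this
    rw [← neg_ne_zero]
    convert this using 1
    ring)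
  refine ⟨a, b, hirr, ?_, ?_⟩
  · push_cast; convert hb1 using 1; ring
  · push_cast; convert hb2 using 1 <;> ring

lemma ediam_cylinder_le {Q R : ℕ} {P S : ℤ} (h : ValidPair Q R P S) :
    Metric.ediam (cylinder Q R P S) ≤ ENNReal.ofReal (cylinderLength Q R) := by
  have hQ' : (0 : ℝ) < Q := by exact_mod_cast h.pos
  have hR' : (0 : ℝ) < R := by exact_mod_cast h.pos.trans_le h.le
  have hdet : (S : ℝ) * Q - P * R = 1 := by exact_mod_cast h.det
  have hsub : cylinder Q R P S ⊆ Set.Icc (((P : ℝ) + S) / (Q + R)) (S / R) := by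
    rintro α ⟨-, h1, h2⟩
    constructor
    · rw [div_le_iff₀ (by positivity)]; linarith
    · rw [le_div_iff₀ hR']; linarith
  refine (Metric.ediam_mono hsub).trans ?_
  rw [Real.ediam_Icc]
  apply ENNReal.ofReal_le_ofReal
  unfold cylinderLength
  apply le_of_eq
  field_simp
  linear_combination hdet

/-- Among the digits `1` and `2` there is one leading to a denominator that is not a multiple of
`q`; following it by the digit `4q` produces a close approximation from below. -/
lemma exists_excluded_digits {q : ℕ} (hq : 2 ≤ q) {Q R : ℕ} {P S : ℤ} (h : ValidPair Q R P S)
    {N : ℕ} (hN : N ≤ Q) : ∃ e : ℕ × ℕ, e.1 ≤ 4 * q ∧ e.2 ≤ 4 * q ∧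
      avoidingSet q N ∩ cylinder (Q + (e.1 + 1) * R) (R + (e.2 + 1) * (Q + (e.1 + 1) * R))
        (P + (e.1 + 1) * S) (S + (e.2 + 1) * (P + (e.1 + 1) * S)) = ∅ := by
  obtain ⟨a, ha, hnd⟩ : ∃ a : ℕ, a ≤ 1 ∧ ¬ q ∣ Q + (a + 1) * R := by
    by_contra hcon
    push Not at hcon
    have h1 : (q : ℤ) ∣ Q + R := by exact_mod_cast (by simpa using hcon 0 (by norm_num))
    have h2 : (q : ℤ) ∣ Q + 2 * R := by exact_mod_cast hcon 1 le_rfl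
    have h3 : (q : ℤ) ∣ 1 := by
      have h4 : (1 : ℤ) = (Q + R) * (2 * S + P) - (Q + 2 * R) * (S + P) := by
        linear_combination -h.det
      rw [h4]
      exact dvd_sub (h1.mul_right _) (h2.mul_right _)
    have h4 : q ∣ 1 := by exact_mod_cast h3
    have := Nat.le_of_dvd one_pos h4
    omega
  refine ⟨(a, 4 * q - 1), by simp only; omega, by simp only; omega, ?_⟩
  simp only
  have hb : 4 * q - 1 + 1 = 4 * q := by omega
  have hc := h.child a (4 * q - 1)
  rw [Set.eq_empty_iff_forall_notMem]
  rintro α ⟨⟨-, hav⟩, -, hη, hηθ⟩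
  have hNQ : N ≤ Q + (a + 1) * R := hN.trans (Nat.le_add_right _ _)
  refine hav _ hNQ (P + (a + 1) * S) ⟨?_, hnd, by linarith, ?_⟩
  · exact ⟨-((R + (4 * q - 1 + 1) * (Q + (a + 1) * R) : ℕ) : ℤ),
      S + (((4 * q - 1 : ℕ) : ℤ) + 1) * (P + (a + 1) * S), by linear_combination hc.det⟩
  · have hdet := hc.det
    have hdet' : ((S + (((4 * q - 1 : ℕ) : ℤ) + 1) * (P + (a + 1) * S) : ℤ) : ℝ) *
        ((Q + (a + 1) * R : ℕ) : ℝ) - ((P + (a + 1) * S : ℤ) : ℝ) *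
        ((R + (4 * q - 1 + 1) * (Q + (a + 1) * R) : ℕ) : ℝ) = 1 := by exact_mod_cast hdet
    have hR : (4 * q * ((Q + (a + 1) * R : ℕ) : ℝ)) <
        ((R + (4 * q - 1 + 1) * (Q + (a + 1) * R) : ℕ) : ℝ) := by
      rw [hb]
      have hR0 : (0 : ℝ) < R := by exact_mod_cast h.pos.trans_le h.le
      push_cast
      linarith
    have hQ0 : (0 : ℝ) < ((Q + (a + 1) * R : ℕ) : ℝ) := by exact_mod_cast hc.pos
    generalize ((Q + (a + 1) * R : ℕ) : ℝ) = x at *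
    generalize ((R + (4 * q - 1 + 1) * (Q + (a + 1) * R) : ℕ) : ℝ) = y at *
    generalize ((P + (a + 1) * S : ℤ) : ℝ) = x' at *
    generalize ((S + (((4 * q - 1 : ℕ) : ℤ) + 1) * (P + (a + 1) * S) : ℤ) : ℝ) = y' at *
    have h1 : y * (x * α - x') + x * (y' - y * α) = 1 := by linear_combination hdet'
    have h2 : 0 < x * (y' - y * α) := mul_pos hQ0 hη
    have h3 : 0 < x * α - x' := by linarith
    nlinarith [mul_lt_mul_of_pos_right hR h3]

lemma cylinderLength_grandchild_le {x y a b : ℝ} (hx : 0 < x) (hy : 0 < y) (ha : 0 ≤ a)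
    (hb : 0 ≤ b) : cylinderLength (x + (a + 1) * y) (y + (b + 1) * (x + (a + 1) * y)) ≤
      1 / 2 * cylinderLength x y := by
  unfold cylinderLength
  rw [div_mul_div_comm, one_mul]
  apply one_div_le_one_div_of_le (by positivity)
  have h1 : x + y ≤ x + (a + 1) * y := by nlinarith
  have h2 : x + 2 * y ≤ y + (b + 1) * (x + (a + 1) * y) := by nlinarith
  calc 2 * (y * (x + y)) ≤ (x + 2 * y) * (x + y) := by nlinarith
    _ ≤ _ := by
      apply mul_le_mul h2 _ (by positivity) (by positivity)
      linarith

/-- Coverings of the part of the avoiding set in a cylinder by arbitrarily small sets, whose sum of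
`s`-th powers of diameters stays bounded: at each step a cylinder is replaced by its grandchildren
other than the excluded one. -/
lemma exists_cover {q : ℕ} (hq : 2 ≤ q) {s : ℝ} (hs : 0 < s)
    (hsum : ∀ x y : ℝ, 0 < x → x ≤ y → ∀ e : ℕ × ℕ, e.1 ≤ 4 * q → e.2 ≤ 4 * q →
      ∑' i : ℕ × ℕ, (if i = e then 0 else
        ENNReal.ofReal (cylinderLength (x + (i.1 + 1 : ℝ) * y)
          (y + (i.2 + 1 : ℝ) * (x + (i.1 + 1 : ℝ) * y))) ^ s) ≤
        ENNReal.ofReal (cylinderLength x y) ^ s) (N n : ℕ) :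
    ∀ {Q R : ℕ} {P S : ℤ}, ValidPair Q R P S → N ≤ Q →
      ∃ (ι : Type) (_ : Countable ι) (t : ι → Set ℝ),
        avoidingSet q N ∩ cylinder Q R P S ⊆ ⋃ i, t i ∧
        (∀ i, Metric.ediam (t i) ≤ ENNReal.ofReal ((1 / 2) ^ n * cylinderLength Q R)) ∧
        ∑' i, Metric.ediam (t i) ^ s ≤ ENNReal.ofReal (cylinderLength Q R) ^ s := by
  induction n with
  | zero =>
    intro Q R P S h _
    refine ⟨Unit, inferInstance, fun _ => cylinder Q R P S, ?_, ?_, ?_⟩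
    · exact fun α hα => Set.mem_iUnion.2 ⟨(), hα.2⟩
    · intro _; simpa using ediam_cylinder_le h
    · rw [tsum_fintype]
      simpa using ENNReal.rpow_le_rpow (ediam_cylinder_le h) hs.le
  | succ n ih =>
    intro Q R P S h hN
    have hQ' : (0 : ℝ) < Q := by exact_mod_cast h.pos
    have hQR' : (Q : ℝ) ≤ R := by exact_mod_cast h.le
    have hR' : (0 : ℝ) < R := hQ'.trans_le hQR'
    obtain ⟨e, he1, he2, he⟩ := exists_excluded_digits hq h hN
    have hchild : ∀ i : ℕ × ℕ, ∃ (ι : Type) (_ : Countable ι) (t : ι → Set ℝ),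
        avoidingSet q N ∩ cylinder (Q + (i.1 + 1) * R) (R + (i.2 + 1) * (Q + (i.1 + 1) * R))
          (P + (i.1 + 1) * S) (S + (i.2 + 1) * (P + (i.1 + 1) * S)) ⊆ ⋃ i, t i ∧
        (∀ j, Metric.ediam (t j) ≤ ENNReal.ofReal ((1 / 2) ^ (n + 1) * cylinderLength Q R)) ∧
        ∑' j, Metric.ediam (t j) ^ s ≤ if i = e then 0 else
          ENNReal.ofReal (cylinderLength (Q + (i.1 + 1 : ℝ) * R)
            (R + (i.2 + 1 : ℝ) * (Q + (i.1 + 1 : ℝ) * R))) ^ s := by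
      intro i
      by_cases hie : i = e
      · subst hie
        refine ⟨Empty, inferInstance, fun _ => ∅, ?_, fun j => j.elim, by simp⟩
        rw [he]
        exact Set.empty_subset _
      · obtain ⟨ι, hι, t, ht1, ht2, ht3⟩ := ih (h.child i.1 i.2)
          (hN.trans (Nat.le_add_right _ _))
        push_cast at ht2 ht3
        refine ⟨ι, hι, t, ht1, fun j => (ht2 j).trans ?_, by rwa [if_neg hie]⟩
        apply ENNReal.ofReal_le_ofReal
        rw [pow_succ, mul_assoc]
        gcongr
        exact cylinderLength_grandchild_le hQ' hR' (by positivity) (by positivity)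
    choose ι hι t ht1 ht2 ht3 using hchild
    refine ⟨Σ i, ι i, inferInstance, fun j => t j.1 j.2, ?_, fun j => ht2 j.1 j.2, ?_⟩
    · rintro α ⟨hα1, hα2⟩
      obtain ⟨a, b, hab⟩ := exists_mem_cylinder_child h hα2
      obtain ⟨j, hj⟩ := Set.mem_iUnion.1 (ht1 (a, b) ⟨hα1, hab⟩)
      exact Set.mem_iUnion.2 ⟨⟨(a, b), j⟩, hj⟩
    · rw [ENNReal.tsum_sigma']
      exact (ENNReal.tsum_le_tsum ht3).trans (hsum _ _ hQ' hQR' e he1 he2)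

lemma exists_cylinder {α : ℝ} (hα : Irrational α) (N : ℕ) :
    ∃ (Q R : ℕ) (P S : ℤ), ValidPair Q R P S ∧ N ≤ Q ∧ α ∈ cylinder Q R P S := by
  induction N with
  | zero =>
    have h0 : 0 < (1 : ℝ) * α - ⌊α⌋ :=
      lt_of_le_of_ne (by rw [one_mul]; exact Int.fract_nonneg α)
        (by simpa using (irrational_mul_sub hα one_pos ⌊α⌋).symm)
    have h1 : (1 : ℝ) * α - ⌊α⌋ < 1 := by rw [one_mul]; exact Int.fract_lt_one α
    obtain ⟨b, hb1, hb2⟩ := exists_digit h0 h1 (fun k => by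
      have := irrational_mul_sub hα (Q := k + 1) (by omega) (1 + (k + 1) * ⌊α⌋)
      push_cast at this
      rw [← neg_ne_zero]
      convert this using 1
      ring)
    refine ⟨1, b + 1, ⌊α⌋, 1 + (b + 1) * ⌊α⌋, ⟨?_, one_pos, by omega⟩, Nat.zero_le _, hα, ?_, ?_⟩
    · push_cast; ring
    · push_cast; convert hb1 using 1; ring
    · push_cast; convert hb2 using 1; ring
  | succ N ih =>
    obtain ⟨Q, R, P, S, h, hN, hmem⟩ := ih
    obtain ⟨a, b, hab⟩ := exists_mem_cylinder_child h hmem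
    refine ⟨_, _, _, _, h.child a b, ?_, hab⟩
    have h1 := Nat.le_mul_of_pos_left R (Nat.succ_pos a)
    have h2 := h.pos
    have h3 := h.le
    simp only [Nat.succ_eq_add_one] at h1
    omega

lemma exists_dimH_avoidingSet_le {q : ℕ} (hq : 2 ≤ q) :
    ∃ s : ℝ≥0, s < 1 ∧ ∀ N, dimH (avoidingSet q N) ≤ s := by
  obtain ⟨s, hs0, hs1, hsum⟩ := exists_tsum_grandchild_le (4 * q)
  refine ⟨⟨s, hs0.le⟩, by exact_mod_cast hs1, fun N => ?_⟩
  have hsub : avoidingSet q N ⊆ ⋃ x : {x : ℕ × ℕ × ℤ × ℤ //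
      ValidPair x.1 x.2.1 x.2.2.1 x.2.2.2 ∧ N ≤ x.1},
      avoidingSet q N ∩ cylinder x.1.1 x.1.2.1 x.1.2.2.1 x.1.2.2.2 := by
    intro α hα
    obtain ⟨Q, R, P, S, h, hN, hmem⟩ := exists_cylinder hα.1 N
    exact Set.mem_iUnion.2 ⟨⟨(Q, R, P, S), h, hN⟩, hα, hmem⟩
  refine (dimH_mono hsub).trans ?_
  rw [dimH_iUnion]
  refine iSup_le ?_
  rintro ⟨⟨Q, R, P, S⟩, h, hN⟩
  simp only at h hN ⊢
  apply dimH_le_of_hausdorffMeasure_ne_top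
  choose ι hι t ht1 ht2 ht3 using fun n => exists_cover hq hs0 hsum N n h hN
  have hr : Tendsto (fun n : ℕ => ENNReal.ofReal ((1 / 2) ^ n * cylinderLength Q R)) atTop
      (𝓝 0) := by
    rw [← ENNReal.ofReal_zero]
    apply ENNReal.tendsto_ofReal
    have := (tendsto_pow_atTop_nhds_zero_of_lt_one (show (0 : ℝ) ≤ 1 / 2 by norm_num)
      (by norm_num)).mul_const (cylinderLength Q R)
    rwa [zero_mul] at this
  have hle := Measure.hausdorffMeasure_le_liminf_tsum s (avoidingSet q N ∩ cylinder Q R P S)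
    _ hr t (Eventually.of_forall ht2) (Eventually.of_forall ht1)
  have hle' : μH[s] (avoidingSet q N ∩ cylinder Q R P S) ≤
      ENNReal.ofReal (cylinderLength Q R) ^ s := by
    refine hle.trans ?_
    refine (liminf_le_liminf (Eventually.of_forall ht3)).trans ?_
    rw [liminf_const]
  exact (hle'.trans_lt (ENNReal.rpow_lt_top_of_nonneg hs0.le ENNReal.ofReal_ne_top)).ne

lemma dimH_oneSideBoundedSet_lt_one {p q : ℕ} (hp : 0 < p) (hpq : p < q)
    (hcop : Nat.Coprime p q) : dimH (oneSideBoundedSet (p / q : ℝ)) < 1 := by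
  obtain ⟨s, hs, hdim⟩ := exists_dimH_avoidingSet_le (show 2 ≤ q by omega)
  have h1 : dimH (⋃ N, avoidingSet q N) ≤ s := by
    rw [dimH_iUnion]
    exact iSup_le hdim
  have h2 : dimH (Neg.neg ⁻¹' (⋃ N, avoidingSet q N)) ≤ s := by
    have := (IsometryEquiv.neg ℝ).dimH_preimage (⋃ N, avoidingSet q N)
    exact this.trans_le h1
  refine (dimH_mono (oneSideBoundedSet_subset hp hpq hcop)).trans_lt ?_
  rw [dimH_union]
  exact (max_le h1 h2).trans_lt (by exact_mod_cast hs)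

lemma isTotallyDisconnected_oneSideBoundedSet (c : ℝ) :
    IsTotallyDisconnected (oneSideBoundedSet c) := by
  intro t ht hpre x hx y hy
  by_contra hne
  wlog hlt : x < y generalizing x y
  · exact this hy hx (Ne.symm hne) (lt_of_le_of_ne (not_lt.1 hlt) (Ne.symm hne))
  obtain ⟨r, hr1, hr2⟩ := exists_rat_btwn hlt
  exact (ht (hpre.Icc_subset hx hy ⟨hr1.le, hr2.le⟩)).1 ⟨r, rfl⟩

end RotationDiscrepancy

theorem theorem1p3 (c : ℚ) (hc0 : 0 < c) (hc1 : c < 1) :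
    -- density in the positive reals
    Set.Ioi (0 : ℝ) ⊆
      closure (RotationDiscrepancy.oneSideBoundedSet (c : ℝ) ∩ Set.Ioi (0 : ℝ)) ∧
    -- first Baire category
    IsMeagre (RotationDiscrepancy.oneSideBoundedSet (c : ℝ)) ∧
    -- Hausdorff dimension strictly between 0 and 1, and its consequences
    0 < dimH (RotationDiscrepancy.oneSideBoundedSet (c : ℝ)) ∧
    dimH (RotationDiscrepancy.oneSideBoundedSet (c : ℝ)) < 1 ∧
    ¬ (RotationDiscrepancy.oneSideBoundedSet (c : ℝ)).Countable ∧
    MeasureTheory.volume (RotationDiscrepancy.oneSideBoundedSet (c : ℝ)) = 0 ∧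
    IsTotallyDisconnected (RotationDiscrepancy.oneSideBoundedSet (c : ℝ)) := by
  obtain ⟨p, q, hp, hpq, hcop, hc⟩ : ∃ p q : ℕ, 0 < p ∧ p < q ∧ Nat.Coprime p q ∧
      (c : ℝ) = (p / q : ℝ) := by
    have hnum : 0 < c.num := Rat.num_pos.2 hc0
    have hnat : (c.num.natAbs : ℤ) = c.num := Int.natAbs_of_nonneg hnum.le
    refine ⟨c.num.natAbs, c.den, by omega, ?_, c.reduced, ?_⟩
    · have := Rat.num_lt_denom_iff.2 hc1
      omega
    · have h1 : ((c.num.natAbs : ℕ) : ℝ) = c.num := by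
        rw [← Int.cast_natCast, hnat]
      rw [h1, Rat.cast_def]
  rw [hc]
  have hpos := RotationDiscrepancy.dimH_oneSideBoundedSet_pos hp hpq
  have hlt := RotationDiscrepancy.dimH_oneSideBoundedSet_lt_one hp hpq hcop
  refine ⟨RotationDiscrepancy.Ioi_subset_closure hp hpq,
    RotationDiscrepancy.isMeagre_oneSideBoundedSet hp hpq hcop, hpos, hlt, ?_, ?_,
    RotationDiscrepancy.isTotallyDisconnected_oneSideBoundedSet _⟩
  · exact fun hcount => hpos.ne' (dimH_countable hcount)
  · rw [← MeasureTheory.hausdorffMeasure_real]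
    have := hausdorffMeasure_of_dimH_lt (d := 1) (by simpa using hlt)
    simpa using this
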